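/- Let $\sigma\in\{1,-1\}$, let $V:\mathbb R\to\mathbb R$ be continuous with $V(x+1)=V(x)$, and let $\psi(x,t)=e^{-i\omega t}\phi(x)$, with $\omega\in\mathbb R$ and $\phi:\mathbb R\to\mathbb R$ not identically zero and either periodic, $\phi(x+1)=\phi(x)$, or antiperiodic, $\phi(x+1)=-\phi(x)$, be a classical standing-wave solution of the Gross–Pitaevskii equation $$i\psi_t=-\tfrac12\psi_{xx}+\sigma|\psi|^2\psi+V(x)\psi .$$ Put $$L_-=-\tfrac12\partial_x^2+V+\sigma\phi^2-\omega,\qquad L_+=-\tfrac12\partial_x^2+V+3\sigma\phi^2-\omega .$$ Writing $\psi=e^{-i\omega t}(\phi+u+iv)$ with $u,v$ real and small, the linearized equation is $u_t=L_-v$, $v_t=-L_+u$. Replacing $iv$ by $v$ and taking time dependence $e^{-i\mu t}$ gives the Bogoliubov problem $$\mu u=L_-v,\qquad \mu v=L_+u ,$$ whose spectrum is the set of spectral values $\mu\in\mathbb C$ of the operator $(u,v)\mapsto(L_-v,L_+u)$ on $L^2(\mathbb R)\times L^2(\mathbb R)$ with domain $H^2(\mathbb R)\times H^2(\mathbb R)$.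 Suppose that $0$ is in the interior of a band of $L_+$, in the sense that $|\mathrm{Tr}\, m_{L_+}(0)|<2$, where $m_{L_+}(0)=U(1)$ and $U$ is the $2\times2$ fundamental matrix, with $U(0)=I$, of the first-order system for $(y,y')$ equivalent to $L_+y=0$. Then the standing wave is exponentially unstable: there is $\delta>0$ such that 1. $i\tau$ belongs to the spectrum of the Bogoliubov problem for every real $\tau$ with $|\tau|<\delta$ (a band of spectrum on the imaginary axis); 2. for every $\gamma\in(0,\delta)$ the linearized equation has a real classical solution $e^{\gamma t}(u(x),v(x))$ with $(u,v)$ bounded on $\mathbb R$ and not identically zero. -/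

import Mathlib

open MeasureTheory

/-- `ψ t x` is a classical solution of the Gross–Pitaevskii equation
`i ψ_t = -(1/2) ψ_xx + σ |ψ|² ψ + V ψ` on the line
(`σ = 1` defocusing, `σ = -1` focusing). -/
def SolvesGrossPitaevskii (σ : ℝ) (V : ℝ → ℝ) (ψ : ℝ → ℝ → ℂ) : Prop :=
  (∀ t, ContDiff ℝ 2 (ψ t)) ∧ (∀ x, Differentiable ℝ fun t => ψ t x) ∧
  ∀ t x, Complex.I * deriv (fun s => ψ s x) t =
    -(1 / 2) * iteratedDeriv 2 (ψ t) x + (σ : ℂ) * (‖ψ t x‖ : ℂ) ^ 2 * ψ t x + (V x : ℂ) * ψ t x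

/-- The standing wave `ψ(x,t) = exp(-iωt) φ(x)` with real profile `φ`. -/
noncomputable def standingWave (ω : ℝ) (φ : ℝ → ℝ) : ℝ → ℝ → ℂ :=
  fun t x => Complex.exp (-Complex.I * ω * t) * (φ x : ℂ)

/-- Zeroth order coefficient of `L₋ = -(1/2)∂² + V + σφ² - ω`. -/
def potMinus (σ : ℝ) (V : ℝ → ℝ) (ω : ℝ) (φ : ℝ → ℝ) (x : ℝ) : ℝ :=
  V x + σ * φ x ^ 2 - ω

/-- Zeroth order coefficient of `L₊ = -(1/2)∂² + V + 3σφ² - ω`. -/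
def potPlus (σ : ℝ) (V : ℝ → ℝ) (ω : ℝ) (φ : ℝ → ℝ) (x : ℝ) : ℝ :=
  V x + 3 * σ * φ x ^ 2 - ω

/-- `m` is the period map at energy `0` of the Schrödinger operator `-(1/2)∂² + q` with
`1`-periodic `q`: `m = U(1)`, where `U` is the fundamental matrix, with `U(0) = I`, of the
first order system for `(y, y')` equivalent to `-(1/2)y'' + q y = 0`. -/
def IsPeriodMap (q : ℝ → ℝ) (m : Matrix (Fin 2) (Fin 2) ℝ) : Prop :=
  ∃ U : ℝ → Matrix (Fin 2) (Fin 2) ℝ,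
    (∀ x i j, HasDerivAt (fun s => U s i j) ((!![0, 1; 2 * q x, 0] * U x) i j) x) ∧
    U 0 = 1 ∧ U 1 = m

/-- Energy `0` lies in the interior of a band of `-(1/2)∂² + q`: the trace of the period map
lies in `(-2, 2)`. -/
def ZeroInBandInterior (q : ℝ → ℝ) : Prop :=
  ∃ m, IsPeriodMap q m ∧ |m.trace| < 2

/-- The complex Hilbert space `L²(ℝ)`. -/
abbrev L2 : Type := Lp ℂ 2 (volume : Measure ℝ)

/-- `g ∈ L²(ℝ)` is the weak second derivative of `f ∈ L²(ℝ)`; such a `g` exists exactly when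
`f` lies in the Sobolev space `H²(ℝ)`. -/
def IsWeakSecondDeriv (f g : L2) : Prop :=
  ∀ η : ℝ → ℝ, ContDiff ℝ ((⊤ : ℕ∞) : WithTop ℕ∞) η → HasCompactSupport η →
    ∫ x, ((iteratedDeriv 2 η x : ℝ) : ℂ) * f x = ∫ x, (η x : ℂ) * g x

/-- The graph of `-(1/2)∂² + q` in `L²(ℝ)`, for bounded `q`, with domain `H²(ℝ)`. -/
def SchrodingerGraph (q : ℝ → ℝ) (f g : L2) : Prop :=
  ∃ f'' : L2, IsWeakSecondDeriv f f'' ∧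
    ∀ᵐ x ∂(volume : Measure ℝ), g x = -(1 / 2) * f'' x + (q x : ℂ) * f x

/-- The graph of the Bogoliubov operator `(u, v) ↦ (L₋ v, L₊ u)` in `L²(ℝ) × L²(ℝ)`, with
domain `H²(ℝ) × H²(ℝ)`. -/
def BogoliubovGraph (σ : ℝ) (V : ℝ → ℝ) (ω : ℝ) (φ : ℝ → ℝ) (f g : L2 × L2) : Prop :=
  SchrodingerGraph (potMinus σ V ω φ) f.2 g.1 ∧ SchrodingerGraph (potPlus σ V ω φ) f.1 g.2

/-- The resolvent set of the Bogoliubov operator `A`: those `μ` for which `A - μ` is a bijection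
from its domain onto `L² × L²` with a bounded inverse `R`, that is,
`(A - μ) f = h` if and only if `f = R h`. (It depends on the norm of `L² × L²` only
through its topology.) -/
def bogoliubovResolventSet (σ : ℝ) (V : ℝ → ℝ) (ω : ℝ) (φ : ℝ → ℝ) : Set ℂ :=
  {μ | ∃ R : L2 × L2 →L[ℂ] L2 × L2, ∀ f h,
    BogoliubovGraph σ V ω φ f (h + μ • f) ↔ f = R h}

/-- The spectrum of the Bogoliubov problem `μ u = L₋ v`, `μ v = L₊ u` on `L²(ℝ) × L²(ℝ)`. -/
def bogoliubovSpectrum (σ : ℝ) (V : ℝ → ℝ) (ω : ℝ) (φ : ℝ → ℝ) : Set ℂ :=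
  (bogoliubovResolventSet σ V ω φ)ᶜ

/-- Classical solutions of the Gross–Pitaevskii equation linearized about the standing wave,
`ψ = exp(-iωt)(φ + u + i v)` with `u`, `v` real and small: `u_t = L₋ v`, `v_t = -L₊ u`.
(In the variables `u` and `i v` this reads `i u_t = L₋ (i v)`, `i (i v)_t = L₊ u`, so that
the time dependence `exp(-iμt)` leads to the Bogoliubov problem.) -/
def SolvesLinearized (σ : ℝ) (V : ℝ → ℝ) (ω : ℝ) (φ : ℝ → ℝ) (u v : ℝ → ℝ → ℝ) : Prop :=
  (∀ t, ContDiff ℝ 2 (u t)) ∧ (∀ t, ContDiff ℝ 2 (v t)) ∧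
  (∀ x, Differentiable ℝ fun t => u t x) ∧ (∀ x, Differentiable ℝ fun t => v t x) ∧
  ∀ t x,
    deriv (fun s => u s x) t =
      -(1 / 2) * iteratedDeriv 2 (v t) x + potMinus σ V ω φ x * v t x ∧
    deriv (fun s => v s x) t =
      -(-(1 / 2) * iteratedDeriv 2 (u t) x + potPlus σ V ω φ x * u t x)

/-- The standing wave is exponentially unstable with rate `γ`: the linearized equation has a
nonzero solution `exp(γt) (u(x), v(x))` that is bounded in space. -/
def ExponentiallyUnstableAtRate (σ : ℝ) (V : ℝ → ℝ) (ω : ℝ) (φ : ℝ → ℝ) (γ : ℝ) : Prop :=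
  0 < γ ∧ ∃ u v : ℝ → ℝ,
    (∃ C, ∀ x, |u x| ≤ C ∧ |v x| ≤ C) ∧ (∃ x, u x ≠ 0 ∨ v x ≠ 0) ∧
    SolvesLinearized σ V ω φ
      (fun t x => Real.exp (γ * t) * u x) (fun t x => Real.exp (γ * t) * v x)

/-! Write `p` and `q` for the potentials of `L₊` and `L₋`. A mode growing like `exp(γt)` satisfies
the real periodic system `u'' = 2pu + 2γv`, `v'' = 2qv - 2γu`. Both conclusions follow once its
period map `M` has an eigenvalue of modulus one for all small real `γ`, since the Floquet solution
is then bounded.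

The system conserves a nondegenerate skew form for every `γ`. Hence the characteristic polynomial of
`M` is reciprocal, and `conj z ^ 2 * det (z - M)` is real on the unit circle (`conj_unitCircleDet`).
At `γ = 0` the system decouples, and at `z = exp(iθ)` this function equals `(2 cos θ - t)(2 cos θ -
2ε)`. Here `t` is the trace for `L₊`, with `|t| < 2`, and `2ε = ±2` is the trace for `L₋`, because
`L₋φ = 0` and `φ` has multiplier `ε`. The second factor never changes sign while the first does, so
the product takes both signs. A strict sign change survives small `γ`, and the intermediate value
theorem gives the eigenvalue (`exists_unit_eigenvalue`, `exists_isBoundedMode`).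

The real or imaginary part of a bounded mode gives the growing solution. Wide cutoffs of the mode
form a Weyl sequence, which puts `iτ` in the spectrum (`IsBoundedMode.mem_bogoliubovSpectrum`). -/

section

open Filter Topology Set

/-! ### Linear differential equations in a Banach algebra -/

section LinearODE

variable {𝔸 : Type*} [NormedRing 𝔸] [NormedAlgebra ℝ 𝔸]

/-- The terms of the Dyson series of the linear equation `Y' = A Y`, `Y 0 = 1`. -/
noncomputable def dysonTerm (A : ℝ → 𝔸) : ℕ → ℝ → 𝔸
  | 0 => fun _ => 1
  | n + 1 => fun x => ∫ s in (0 : ℝ)..x, A s * dysonTerm A n s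

theorem dysonTerm_apply_zero (A : ℝ → 𝔸) (n : ℕ) :
    dysonTerm A n 0 = if n = 0 then 1 else 0 := by
  cases n <;> simp [dysonTerm]

theorem continuous_dysonTerm {A : ℝ → 𝔸} (hA : Continuous A) (n : ℕ) :
    Continuous (dysonTerm A n) := by
  induction n with
  | zero => exact continuous_const
  | succ n ih =>
    exact intervalIntegral.continuous_primitive
      (fun a b => (hA.mul ih).intervalIntegrable a b) 0

theorem hasDerivAt_dysonTerm_succ [CompleteSpace 𝔸] {A : ℝ → 𝔸} (hA : Continuous A) (n : ℕ) (x : ℝ) :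
    HasDerivAt (dysonTerm A (n + 1)) (A x * dysonTerm A n x) x :=
  ((hA.mul (continuous_dysonTerm hA n)).integral_hasStrictDerivAt 0 x).hasDerivAt

/-- Each integration gains a factor `K|x|/(n+1)`, as in the exponential series. The norm of `1`
stays because it need not equal one in a normed ring. -/
theorem norm_dysonTerm_le {A : ℝ → 𝔸} (hA : Continuous A) {K : ℝ} (hK : ∀ x, ‖A x‖ ≤ K)
    (n : ℕ) (x : ℝ) :
    ‖dysonTerm A n x‖ ≤ ‖(1 : 𝔸)‖ * ((K * |x|) ^ n / n.factorial) := by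
  have hK0 : 0 ≤ K := (norm_nonneg _).trans (hK 0)
  induction n generalizing x with
  | zero => simp [dysonTerm]
  | succ n ih =>
    have hint : ∀ f : ℝ → ℝ, Continuous f → IntegrableOn f (uIoc 0 x) := fun f hf =>
      (intervalIntegrable_iff.1 (hf.intervalIntegrable 0 x))
    calc ‖dysonTerm A (n + 1) x‖
        ≤ ∫ s in uIoc 0 x, ‖A s * dysonTerm A n s‖ :=
          intervalIntegral.norm_integral_le_integral_norm_uIoc
      _ ≤ ∫ s in uIoc 0 x, (‖(1 : 𝔸)‖ * K ^ (n + 1) / n.factorial) * |s - 0| ^ n := by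
          refine integral_mono (hint _ (hA.mul (continuous_dysonTerm hA n)).norm)
            (hint _ (by fun_prop)) fun s => ?_
          calc ‖A s * dysonTerm A n s‖ ≤ K * (‖(1 : 𝔸)‖ * ((K * |s|) ^ n / n.factorial)) :=
                (norm_mul_le _ _).trans (mul_le_mul (hK s) (ih s) (norm_nonneg _) hK0)
            _ = _ := by rw [sub_zero]; ring
      _ = _ := by
          rw [integral_const_mul, integral_pow_abs_sub_uIoc, sub_zero, Nat.factorial_succ]
          push_cast
          field_simp
          ring

theorem exists_fundamental_solution [CompleteSpace 𝔸] {A : ℝ → 𝔸} (hA : Continuous A) {K : ℝ}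
    (hK : ∀ x, ‖A x‖ ≤ K) :
    ∃ Y : ℝ → 𝔸, Y 0 = 1 ∧ ∀ x, HasDerivAt Y (A x * Y x) x := by
  have hK0 : 0 ≤ K := (norm_nonneg _).trans (hK 0)
  have hsum : ∀ x, Summable fun n => dysonTerm A n x := fun x =>
    .of_norm_bounded ((Real.summable_pow_div_factorial (K * |x|)).mul_left ‖(1 : 𝔸)‖)
      fun n => norm_dysonTerm_le hA hK n x
  -- The constant zeroth term is split off: differentiating term `n + 1` gives `A` times term `n`,
  -- so the derived series is `A` times the full sum.
  refine ⟨fun x => 1 + ∑' n, dysonTerm A (n + 1) x, by simp [dysonTerm_apply_zero], fun x => ?_⟩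
  have key := hasDerivAt_tsum_of_isPreconnected (𝕜 := ℝ)
    (u := fun n : ℕ => K * (‖(1 : 𝔸)‖ * ((K * (|x| + 1)) ^ n / n.factorial)))
    (g := fun n => dysonTerm A (n + 1)) (g' := fun n y => A y * dysonTerm A n y)
    (t := Metric.ball 0 (|x| + 1)) (y₀ := x) (y := x)
    (((Real.summable_pow_div_factorial _).mul_left _).mul_left _)
    Metric.isOpen_ball (convex_ball _ _).isPreconnected
    (fun n y _ => hasDerivAt_dysonTerm_succ hA n y)
    (fun n y hy => by
      have hy' : |y| ≤ |x| + 1 := by simpa using (mem_ball_zero_iff.1 hy).le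
      refine (norm_mul_le _ _).trans
        (mul_le_mul (hK y) ((norm_dysonTerm_le hA hK n y).trans ?_) (norm_nonneg _) hK0)
      gcongr)
    (by simp) ((summable_nat_add_iff 1).2 (hsum x)) (by simp)
  have h1 : ∑' n, A x * dysonTerm A n x = A x * (1 + ∑' n, dysonTerm A (n + 1) x) := by
    rw [(hsum x).tsum_mul_left, (hsum x).tsum_eq_zero_add]
    rfl
  rw [← h1]
  exact key.const_add 1

theorem linear_ode_unique {A : ℝ → 𝔸} {K : ℝ} (hK : ∀ x, ‖A x‖ ≤ K) {Y Z : ℝ → 𝔸}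
    (hY : ∀ x, HasDerivAt Y (A x * Y x) x) (hZ : ∀ x, HasDerivAt Z (A x * Z x) x)
    (h0 : Y 0 = Z 0) : Y = Z := by
  refine ODE_solution_unique_univ (v := fun x y => A x * y) (s := fun _ => univ) (K := K.toNNReal)
    (t₀ := 0) (fun t => LipschitzWith.lipschitzOnWith ?_)
    (fun t => ⟨hY t, mem_univ _⟩) (fun t => ⟨hZ t, mem_univ _⟩) h0
  refine LipschitzWith.of_dist_le_mul fun y z => ?_
  rw [dist_eq_norm, dist_eq_norm, ← mul_sub]
  exact (norm_mul_le _ _).trans (by gcongr; exact (hK t).trans (Real.le_coe_toNNReal K))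

/-- The difference from the unperturbed solution starts at zero and is forced by `γ B Y₀`, so
Grönwall bounds it by a quantity that vanishes with `γ`. -/
theorem tendsto_linear_ode_perturbation {A : ℝ → 𝔸} {K : ℝ} (hK : ∀ x, ‖A x‖ ≤ K) (B : 𝔸)
    {Y : ℝ → ℝ → 𝔸} (hY : ∀ γ x, HasDerivAt (Y γ) ((A x + γ • B) * Y γ x) x)
    (h0 : ∀ γ, Y γ 0 = 1) : Tendsto (fun γ => Y γ 1) (𝓝 0) (𝓝 (Y 0 1)) := by
  have hcont : ∀ γ, Continuous (Y γ) := fun γ =>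
    continuous_iff_continuousAt.2 fun x => (hY γ x).continuousAt
  obtain ⟨M, hM⟩ := isCompact_Icc.exists_bound_of_continuousOn
    (hcont 0).continuousOn (s := Icc (0 : ℝ) 1)
  have hlim : Tendsto (fun γ : ℝ => gronwallBound 0 (K + ‖B‖) (|γ| * (‖B‖ * M)) 1) (𝓝 0) (𝓝 0) := by
    have h1 : Continuous fun γ : ℝ => gronwallBound 0 (K + ‖B‖) (|γ| * (‖B‖ * M)) 1 :=
      (gronwallBound_continuous_ε 0 (K + ‖B‖) 1).comp (by fun_prop)
    simpa [gronwallBound_ε0_δ0] using h1.tendsto 0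
  rw [tendsto_iff_norm_sub_tendsto_zero]
  refine squeeze_zero' (.of_forall fun _ => norm_nonneg _) ?_ hlim
  -- Keeping `|γ| ≤ 1` makes the Grönwall rate `K + ‖B‖` uniform in `γ`.
  filter_upwards [Metric.ball_mem_nhds (0 : ℝ) one_pos] with γ hγ
  have hγ1 : |γ| ≤ 1 := by simpa using (mem_ball_zero_iff.1 hγ).le
  have := norm_le_gronwallBound_of_norm_deriv_right_le (f := fun x => Y γ x - Y 0 x)
    (f' := fun x => (A x + γ • B) * Y γ x - (A x + (0 : ℝ) • B) * Y 0 x)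
    (δ := 0) (K := K + ‖B‖) (ε := |γ| * (‖B‖ * M)) (a := 0) (b := 1)
    ((hcont γ).sub (hcont 0)).continuousOn
    (fun x _ => ((hY γ x).sub (hY 0 x)).hasDerivWithinAt) (by simp [h0]) ?_ 1 (by simp)
  · simpa using this
  · intro x hx
    have hsplit : (A x + γ • B) * Y γ x - (A x + (0 : ℝ) • B) * Y 0 x =
        (A x + γ • B) * (Y γ x - Y 0 x) + γ • (B * Y 0 x) := by
      rw [zero_smul, add_zero, mul_sub, add_mul, add_mul, smul_mul_assoc, smul_mul_assoc]
      abel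
    rw [hsplit]
    refine (norm_add_le _ _).trans (add_le_add ((norm_mul_le _ _).trans ?_) ?_)
    · refine mul_le_mul_of_nonneg_right ((norm_add_le _ _).trans (add_le_add (hK x) ?_))
        (norm_nonneg _)
      rw [norm_smul, Real.norm_eq_abs]
      exact mul_le_of_le_one_left (norm_nonneg _) hγ1
    · rw [norm_smul, Real.norm_eq_abs]
      gcongr
      exact (norm_mul_le _ _).trans (by gcongr; exact hM x ⟨hx.1, hx.2.le⟩)

end LinearODE

end

/-! ### Reciprocal characteristic polynomials on the unit circle -/

section

open scoped Matrix.Norms.Operator Matrix ComplexConjugate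

/-- From `Mᵀ J M = J` one gets `Mᵀ J (z - M) = (z Mᵀ - 1) J`. Taking determinants cancels `J`, and
`z M - 1 = -z (w - M)` when `w = 1/z`. -/
theorem det_sub_eq_of_conserved_form {n R : Type*} [Fintype n] [DecidableEq n] [Field R]
    {J M : Matrix n n R} (hJ : J.det ≠ 0) (hM : Mᵀ * J * M = J) (hdet : M.det = 1) {z w : R}
    (hzw : z * w = 1) (hn : Even (Fintype.card n)) :
    (z • (1 : Matrix n n R) - M).det = z ^ Fintype.card n * (w • (1 : Matrix n n R) - M).det := by
  have h1 : Mᵀ * J * (z • 1 - M) = (z • Mᵀ - 1) * J := by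
    rw [mul_sub, hM, Matrix.mul_smul, mul_one, sub_mul, Matrix.smul_mul, one_mul]
  have h2 := congrArg Matrix.det h1
  rw [Matrix.det_mul, Matrix.det_mul, Matrix.det_mul, Matrix.det_transpose, hdet, one_mul,
    mul_comm] at h2
  rw [mul_right_cancel₀ hJ h2, ← Matrix.det_transpose, Matrix.transpose_sub,
    Matrix.transpose_smul, Matrix.transpose_transpose, Matrix.transpose_one]
  have h3 : z • M - 1 = z • (-(w • (1 : Matrix n n R) - M)) := by
    rw [neg_sub, smul_sub, smul_smul, hzw, one_smul]
  rw [h3, Matrix.det_smul, Matrix.det_neg, hn.neg_one_pow, one_mul]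

/-- For a real matrix `M` of size `4`, the number `conj z ^ 2 * det (z - M)` at `z = exp(iθ)`. -/
noncomputable def unitCircleDet (M : Matrix (Fin 2 ⊕ Fin 2) (Fin 2 ⊕ Fin 2) ℝ) (θ : ℝ) : ℂ :=
  conj (Complex.exp (θ * Complex.I)) ^ 2 *
    (Complex.exp (θ * Complex.I) • (1 : Matrix (Fin 2 ⊕ Fin 2) (Fin 2 ⊕ Fin 2) ℂ) -
      M.map Complex.ofReal).det

theorem conj_exp_mul_I_mul (θ : ℝ) :
    Complex.exp (θ * Complex.I) * conj (Complex.exp (θ * Complex.I)) = 1 := by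
  rw [Complex.mul_conj, Complex.normSq_eq_norm_sq, Complex.norm_exp_ofReal_mul_I]
  simp

/-- On the circle conjugation is inversion, so reciprocity relates the determinant at `z` to its
conjugate by a factor `z ^ 4`; the weight `conj z ^ 2` splits this factor evenly. -/
theorem conj_unitCircleDet {J M : Matrix (Fin 2 ⊕ Fin 2) (Fin 2 ⊕ Fin 2) ℝ} (hJ : J.det ≠ 0)
    (hM : Mᵀ * J * M = J) (hdet : M.det = 1) (θ : ℝ) :
    conj (unitCircleDet M θ) = unitCircleDet M θ := by
  have hz := conj_exp_mul_I_mul θ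
  have h := det_sub_eq_of_conserved_form (J := J.map Complex.ofReal) (M := M.map Complex.ofReal)
    (by
      have := Complex.ofRealHom.map_det J
      rw [RingHom.mapMatrix_apply] at this
      change Matrix.det (J.map Complex.ofRealHom) ≠ 0
      rw [← this]
      simpa using hJ)
    (by
      have := congrArg (Complex.ofRealHom.mapMatrix (m := Fin 2 ⊕ Fin 2)) hM
      rw [map_mul, map_mul] at this
      simp only [RingHom.mapMatrix_apply] at this
      exact this)
    (by
      have := Complex.ofRealHom.map_det M
      rw [RingHom.mapMatrix_apply, hdet] at this
      exact this.symm.trans (map_one _))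
    hz (by simp; decide)
  have hconj : conj (Complex.exp (θ * Complex.I) • (1 : Matrix (Fin 2 ⊕ Fin 2) (Fin 2 ⊕ Fin 2) ℂ) -
      M.map Complex.ofReal).det = (conj (Complex.exp (θ * Complex.I)) •
        (1 : Matrix (Fin 2 ⊕ Fin 2) (Fin 2 ⊕ Fin 2) ℂ) - M.map Complex.ofReal).det := by
    rw [RingHom.map_det]
    congr 1
    ext i j
    simp only [RingHom.mapMatrix_apply, Matrix.map_apply, Matrix.sub_apply, Matrix.smul_apply,
      smul_eq_mul, map_sub, map_mul, Complex.conj_ofReal, Matrix.one_apply]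
    split_ifs <;> simp
  rw [unitCircleDet, map_mul, map_pow, Complex.conj_conj, hconj, h]
  have hcard : Fintype.card (Fin 2 ⊕ Fin 2) = 4 := by simp
  rw [hcard]
  set z := Complex.exp (θ * Complex.I)
  linear_combination (-(z ^ 2) * (z * conj z + 1) *
    (conj z • (1 : Matrix (Fin 2 ⊕ Fin 2) (Fin 2 ⊕ Fin 2) ℂ) - M.map Complex.ofReal).det) * hz

theorem continuous_unitCircleDet {X : Type*} [TopologicalSpace X]
    {f : X → Matrix (Fin 2 ⊕ Fin 2) (Fin 2 ⊕ Fin 2) ℝ} {g : X → ℝ} (hf : Continuous f)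
    (hg : Continuous g) : Continuous fun x => unitCircleDet (f x) (g x) := by
  unfold unitCircleDet
  refine Continuous.mul (by fun_prop) (Continuous.matrix_det ?_)
  exact Continuous.sub (by fun_prop) (hf.matrix_map Complex.continuous_ofReal)

/-- Each block of determinant one contributes `conj z * (z ^ 2 - s z + 1) = z + conj z - s`, where
`s` is its trace. -/
theorem unitCircleDet_fromBlocks {U W : Matrix (Fin 2) (Fin 2) ℝ} (hU : U.det = 1)
    (hW : W.det = 1) (θ : ℝ) :
    unitCircleDet (Matrix.fromBlocks U 0 0 W) θ =
      ((2 * Real.cos θ - U.trace) * (2 * Real.cos θ - W.trace) : ℝ) := by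
  have hz := conj_exp_mul_I_mul θ
  have hcos : (2 * Real.cos θ : ℂ) =
      Complex.exp (θ * Complex.I) + conj (Complex.exp (θ * Complex.I)) := by
    rw [Complex.add_conj, Complex.exp_ofReal_mul_I_re]; push_cast; ring
  have hblock : ∀ U : Matrix (Fin 2) (Fin 2) ℝ, U.det = 1 → ∀ z : ℂ,
      (z • (1 : Matrix (Fin 2) (Fin 2) ℂ) - U.map Complex.ofReal).det =
        z ^ 2 - U.trace * z + 1 := by
    intro U hU z
    rw [Matrix.det_fin_two] at hU ⊢
    have hU' : (U 0 0 * U 1 1 - U 0 1 * U 1 0 : ℂ) = 1 := by exact_mod_cast hU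
    simp [Matrix.trace_fin_two]
    linear_combination hU'
  have hdet : (Complex.exp (θ * Complex.I) • (1 : Matrix (Fin 2 ⊕ Fin 2) (Fin 2 ⊕ Fin 2) ℂ) -
      (Matrix.fromBlocks U 0 0 W).map Complex.ofReal) =
      Matrix.fromBlocks (Complex.exp (θ * Complex.I) • 1 - U.map Complex.ofReal) 0 0
        (Complex.exp (θ * Complex.I) • 1 - W.map Complex.ofReal) := by
    rw [← Matrix.fromBlocks_one, Matrix.fromBlocks_map, Matrix.fromBlocks_smul]
    ext (i | i) (j | j) <;> simp
  rw [unitCircleDet, hdet, Matrix.det_fromBlocks_zero₂₁, hblock U hU, hblock W hW]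
  push_cast at hcos ⊢
  rw [hcos]
  generalize Complex.exp (θ * Complex.I) = z at *
  generalize conj z = w at *
  generalize (U.trace : ℂ) = s at *
  generalize (W.trace : ℂ) = t at *
  have h1 : w * (z ^ 2 - s * z + 1) = z + w - s := by linear_combination (z - s) * hz
  have h2 : w * (z ^ 2 - t * z + 1) = z + w - t := by linear_combination (z - t) * hz
  rw [← h1, ← h2]; ring

/-- A real continuous function of `θ` with values of both signs vanishes somewhere. Taking
determinants in the conserved form only gives `det M = ±1`; positivity selects the sign. -/
theorem exists_unit_eigenvalue {J M : Matrix (Fin 2 ⊕ Fin 2) (Fin 2 ⊕ Fin 2) ℝ} (hJ : J.det ≠ 0)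
    (hM : Mᵀ * J * M = J) (hdet : 0 < M.det) {θ₁ θ₂ : ℝ}
    (hsign : (unitCircleDet M θ₁).re * (unitCircleDet M θ₂).re < 0) :
    ∃ z : ℂ, ‖z‖ = 1 ∧ ∃ w : Fin 2 ⊕ Fin 2 → ℂ, w ≠ 0 ∧ M.map Complex.ofReal *ᵥ w = z • w := by
  have hdet1 : M.det = 1 := by
    have := congrArg Matrix.det hM
    rw [Matrix.det_mul, Matrix.det_mul, Matrix.det_transpose] at this
    generalize M.det = d at *
    generalize J.det = e at *
    have h2 : (d * d - 1) * e = 0 := by linear_combination this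
    have h3 := (mul_eq_zero.1 h2).resolve_right hJ
    nlinarith
  have hcont : Continuous fun θ => (unitCircleDet M θ).re :=
    Complex.continuous_re.comp (continuous_unitCircleDet continuous_const continuous_id)
  obtain ⟨θ, hθ⟩ : ∃ θ, (unitCircleDet M θ).re = 0 := by
    rcases mul_neg_iff.1 hsign with ⟨h1, h2⟩ | ⟨h1, h2⟩
    · exact mem_range_of_exists_le_of_exists_ge hcont ⟨θ₂, h2.le⟩ ⟨θ₁, h1.le⟩
    · exact mem_range_of_exists_le_of_exists_ge hcont ⟨θ₁, h1.le⟩ ⟨θ₂, h2.le⟩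
  have hzero : unitCircleDet M θ = 0 :=
    Complex.ext hθ (Complex.conj_eq_iff_im.1 (conj_unitCircleDet hJ hM hdet1 θ))
  refine ⟨Complex.exp (θ * Complex.I), Complex.norm_exp_ofReal_mul_I θ, ?_⟩
  have hz := conj_exp_mul_I_mul θ
  have h0 := (mul_eq_zero.1 hzero).resolve_left
    (pow_ne_zero 2 (right_ne_zero_of_mul (hz.trans_ne one_ne_zero)))
  obtain ⟨w, hw, hw0⟩ := Matrix.exists_mulVec_eq_zero_iff.2 h0
  refine ⟨w, hw, ?_⟩
  rw [Matrix.sub_mulVec, Matrix.smul_mulVec, Matrix.one_mulVec, sub_eq_zero] at hw0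
  exact hw0.symm

end

/-! ### Conserved forms and Floquet theory -/

section

open scoped Matrix.Norms.Operator Matrix ComplexConjugate

section Entries

variable {m : Type*} [Fintype m]

theorem HasDerivAt.matrix_entry {Y : ℝ → Matrix m m ℝ} {Y' : Matrix m m ℝ} {x : ℝ}
    (h : HasDerivAt Y Y' x) (i j : m) : HasDerivAt (fun s => Y s i j) (Y' i j) x :=
  ((Matrix.entryLinearMap ℝ ℝ i j).toContinuousLinearMap.hasFDerivAt.comp_hasDerivAt x h :)

theorem HasDerivAt.of_matrix_entry [DecidableEq m] {Y : ℝ → Matrix m m ℝ} {Y' : Matrix m m ℝ} {x : ℝ}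
    (h : ∀ i j, HasDerivAt (fun s => Y s i j) (Y' i j) x) : HasDerivAt Y Y' x := by
  have h1 := HasDerivAt.fun_sum (u := Finset.univ) fun i _ =>
    HasDerivAt.fun_sum (u := Finset.univ) fun j _ =>
      (h i j).smul_const (Matrix.single i j (1 : ℝ))
  have h2 : ∀ M : Matrix m m ℝ, ∑ i, ∑ j, M i j • Matrix.single i j (1 : ℝ) = M := fun M => by
    conv_rhs => rw [Matrix.matrix_eq_sum_single M]
    simp
  simp only [h2] at h1
  exact h1

theorem HasDerivAt.matrix_transpose [DecidableEq m] {Y : ℝ → Matrix m m ℝ} {Y' : Matrix m m ℝ} {x : ℝ}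
    (h : HasDerivAt Y Y' x) : HasDerivAt (fun s => (Y s)ᵀ) Y'ᵀ x :=
  HasDerivAt.of_matrix_entry fun i j => h.matrix_entry j i

/-- If `Aᵀ J + J A = 0` then `Yᵀ J Y` is conserved along `Y' = A Y`. -/
theorem conserved_form_of_linear_ode [DecidableEq m] {J : Matrix m m ℝ} {A Y : ℝ → Matrix m m ℝ}
    (hJ : ∀ x, (A x)ᵀ * J + J * A x = 0) (hY : ∀ x, HasDerivAt Y (A x * Y x) x) (h0 : Y 0 = 1)
    (x : ℝ) : (Y x)ᵀ * J * Y x = J := by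
  have hd : ∀ x, HasDerivAt (fun x => (Y x)ᵀ * J * Y x) 0 x := fun x => by
    have h := ((hY x).matrix_transpose.mul_const J).mul (hY x)
    have h1 : (A x * Y x)ᵀ * J * Y x + (Y x)ᵀ * J * (A x * Y x) =
        (Y x)ᵀ * ((A x)ᵀ * J + J * A x) * Y x := by
      rw [Matrix.transpose_mul]; noncomm_ring
    rw [h1, hJ, mul_zero, zero_mul] at h
    exact h
  have := is_const_of_deriv_eq_zero (fun x => (hd x).differentiableAt) (fun x => (hd x).deriv) x 0
  simpa [h0] using this

end Entries

/-- Coefficient matrix of `(y, y')' = A (y, y')` for the equation `-(1/2)y'' + q y = 0`. -/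
def schrodingerMatrix (q : ℝ) : Matrix (Fin 2) (Fin 2) ℝ := !![0, 1; 2 * q, 0]

/-- The standard symplectic form of the plane. -/
def planeForm : Matrix (Fin 2) (Fin 2) ℝ := !![0, 1; -1, 0]

theorem planeForm_conserved (q : ℝ) :
    (schrodingerMatrix q)ᵀ * planeForm + planeForm * schrodingerMatrix q = 0 := by
  ext i j
  fin_cases i <;> fin_cases j <;> simp [schrodingerMatrix, planeForm, Matrix.mul_apply]

/-- Coefficients of the system for `(u, u', v, v')` without the coupling. -/
def decoupledMatrix (p q : ℝ) : Matrix (Fin 2 ⊕ Fin 2) (Fin 2 ⊕ Fin 2) ℝ :=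
  Matrix.fromBlocks (schrodingerMatrix p) 0 0 (schrodingerMatrix q)

/-- Coupling of the system for `(u, u', v, v')`, per unit of the growth rate. -/
def couplingMatrix : Matrix (Fin 2 ⊕ Fin 2) (Fin 2 ⊕ Fin 2) ℝ :=
  Matrix.fromBlocks 0 !![0, 0; 2, 0] !![0, 0; -2, 0] 0

/-- Skew form conserved by the system for `(u, u', v, v')`. -/
def coupledForm : Matrix (Fin 2 ⊕ Fin 2) (Fin 2 ⊕ Fin 2) ℝ :=
  Matrix.fromBlocks planeForm 0 0 (-planeForm)

theorem det_coupledForm_ne_zero : coupledForm.det ≠ 0 := by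
  rw [coupledForm, Matrix.det_fromBlocks_zero₂₁]
  simp [planeForm, Matrix.det_fin_two]

/-- The two coupling blocks have opposite signs, and so do the two plane forms; this makes the
off-diagonal terms cancel for every `γ`. -/
theorem coupledForm_conserved (p q γ : ℝ) :
    (decoupledMatrix p q + γ • couplingMatrix)ᵀ * coupledForm +
      coupledForm * (decoupledMatrix p q + γ • couplingMatrix) = 0 := by
  have hp := planeForm_conserved p
  have hq := planeForm_conserved q
  rw [decoupledMatrix, couplingMatrix, coupledForm, Matrix.fromBlocks_smul, Matrix.fromBlocks_add,
    Matrix.fromBlocks_transpose, Matrix.fromBlocks_multiply, Matrix.fromBlocks_multiply,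
    Matrix.fromBlocks_add, ← Matrix.fromBlocks_zero]
  congr 1
  · simpa using hp
  · ext i j
    fin_cases i <;> fin_cases j <;> simp [planeForm, Matrix.mul_apply]
  · ext i j
    fin_cases i <;> fin_cases j <;> simp [planeForm, Matrix.mul_apply]
  · simp only [smul_zero, add_zero, zero_add, Matrix.mul_neg,
      Matrix.neg_mul, mul_zero, zero_mul]
    rw [← neg_add, hq, neg_zero]

theorem continuous_decoupledMatrix {p q : ℝ → ℝ} (hp : Continuous p) (hq : Continuous q) :
    Continuous fun x => decoupledMatrix (p x) (q x) := by
  refine continuous_matrix fun i j => ?_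
  rcases i with i | i <;> rcases j with j | j <;> fin_cases i <;> fin_cases j <;>
    simp [decoupledMatrix, schrodingerMatrix] <;> fun_prop

theorem continuous_schrodingerMatrix {q : ℝ → ℝ} (hq : Continuous q) :
    Continuous fun x => schrodingerMatrix (q x) := by
  refine continuous_matrix fun i j => ?_
  fin_cases i <;> fin_cases j <;> simp [schrodingerMatrix] <;> fun_prop

theorem exists_bound_of_periodic {E : Type*} [NormedAddCommGroup E] {A : ℝ → E}
    (hA : Continuous A) (hper : Function.Periodic A 1) : ∃ K, ∀ x, ‖A x‖ ≤ K := by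
  obtain ⟨K, hK⟩ := (hper.isBounded_of_continuous one_ne_zero hA).exists_norm_le
  exact ⟨K, fun x => hK _ ⟨x, rfl⟩⟩

/-- Floquet: the fundamental solution of a `1`-periodic system. -/
theorem fundamental_solution_add_one {𝔸 : Type*} [NormedRing 𝔸] [NormedAlgebra ℝ 𝔸] {A Y : ℝ → 𝔸}
    {K : ℝ} (hK : ∀ x, ‖A x‖ ≤ K) (hper : Function.Periodic A 1)
    (hY : ∀ x, HasDerivAt Y (A x * Y x) x) (h0 : Y 0 = 1) (x : ℝ) : Y (x + 1) = Y x * Y 1 := by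
  refine congrFun (linear_ode_unique hK (Y := fun x => Y (x + 1)) (Z := fun x => Y x * Y 1)
    (fun x => ?_) (fun x => ?_) ?_) x
  · have := (hY (x + 1)).comp_add_const x 1
    rwa [hper x] at this
  · simpa [mul_assoc] using (hY x).mul_const (Y 1)
  · simp [h0]

theorem det_eq_one_of_planeForm {M : Matrix (Fin 2) (Fin 2) ℝ}
    (hM : Mᵀ * planeForm * M = planeForm) : M.det = 1 := by
  have := congrFun (congrFun hM 0) 1
  simp [planeForm, Matrix.mul_apply, Fin.sum_univ_two, Matrix.transpose_apply] at this
  rw [Matrix.det_fin_two]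
  linarith

/-- The trace of the period map is `2ε` if there is a solution with multiplier `ε = ±1`. -/
theorem trace_of_multiplier {M : Matrix (Fin 2) (Fin 2) ℝ} (hdet : M.det = 1) {ε : ℝ}
    (hε : ε ^ 2 = 1) {w : Fin 2 → ℝ} (hw : w ≠ 0) (hMw : M *ᵥ w = ε • w) :
    M.trace = 2 * ε := by
  have h0 : (M - ε • (1 : Matrix (Fin 2) (Fin 2) ℝ)).det = 0 := by
    refine Matrix.exists_mulVec_eq_zero_iff.1 ⟨w, hw, ?_⟩
    rw [Matrix.sub_mulVec, hMw, Matrix.smul_mulVec, Matrix.one_mulVec, sub_self]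
  rw [Matrix.det_fin_two] at h0 hdet
  rw [Matrix.trace_fin_two]
  simp at h0
  linear_combination ε * hdet - ε * h0 - (M 0 0 + M 1 1 - ε) * hε

end

/-! ### Bounded modes for small growth rates -/

section

open scoped Matrix.Norms.Operator Matrix ComplexConjugate
open Filter Topology Set

/-- `(u, v)`, with derivatives `(u₁, v₁)`, is a nontrivial solution of
`-(1/2)u'' + p u = -γ v`, `-(1/2)v'' + q v = γ u`, bounded together with its derivatives. -/
structure IsBoundedMode (p q : ℝ → ℝ) (γ : ℝ) (u u₁ v v₁ : ℝ → ℂ) : Prop where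
  deriv_u : ∀ x, HasDerivAt u (u₁ x) x
  deriv_u₁ : ∀ x, HasDerivAt u₁ (2 * p x * u x + 2 * γ * v x) x
  deriv_v : ∀ x, HasDerivAt v (v₁ x) x
  deriv_v₁ : ∀ x, HasDerivAt v₁ (2 * q x * v x - 2 * γ * u x) x
  bounded : ∃ C, ∀ x, ‖u x‖ ≤ C ∧ ‖u₁ x‖ ≤ C ∧ ‖v x‖ ≤ C ∧ ‖v₁ x‖ ≤ C
  nontrivial : ∃ x, u x ≠ 0 ∨ v x ≠ 0

theorem hasDerivAt_mulVec {m : Type*} [Fintype m] {A Y : ℝ → Matrix m m ℝ} (w : m → ℂ) {x : ℝ}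
    (hY : HasDerivAt Y (A x * Y x) x) (i : m) :
    HasDerivAt (fun x => ((Y x).map Complex.ofReal *ᵥ w) i)
      (∑ k, (A x i k : ℂ) * ((Y x).map Complex.ofReal *ᵥ w) k) x := by
  have h := HasDerivAt.fun_sum (u := Finset.univ) fun j _ =>
    (hY.matrix_entry i j).ofReal_comp.mul_const (w j)
  refine HasDerivAt.congr_deriv (f := fun x => ((Y x).map Complex.ofReal *ᵥ w) i) h ?_
  simp only [Matrix.mulVec, dotProduct, Matrix.map_apply, Matrix.mul_apply, Complex.ofReal_sum,
    Complex.ofReal_mul, Finset.mul_sum, Finset.sum_mul]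
  rw [Finset.sum_comm]
  simp only [mul_assoc]

/-- The solution starting at the eigenvector is multiplied by `z` over each period, so the absolute
values of its components are periodic and continuous, hence bounded. -/
theorem exists_isBoundedMode_of_multiplier {p q : ℝ → ℝ} (hp : Continuous p) (hq : Continuous q)
    (hpper : Function.Periodic p 1) (hqper : Function.Periodic q 1) {γ : ℝ}
    {Y : ℝ → Matrix (Fin 2 ⊕ Fin 2) (Fin 2 ⊕ Fin 2) ℝ}
    (hY : ∀ x, HasDerivAt Y ((decoupledMatrix (p x) (q x) + γ • couplingMatrix) * Y x) x)
    (h0 : Y 0 = 1) {z : ℂ} (hz : ‖z‖ = 1) {w : Fin 2 ⊕ Fin 2 → ℂ} (hw : w ≠ 0)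
    (hzw : (Y 1).map Complex.ofReal *ᵥ w = z • w) :
    ∃ u u₁ v v₁ : ℝ → ℂ, IsBoundedMode p q γ u u₁ v v₁ := by
  have hper : Function.Periodic
      (fun x => decoupledMatrix (p x) (q x) + γ • couplingMatrix) 1 := fun x => by
    simp only [hpper x, hqper x]
  obtain ⟨K, hK⟩ := exists_bound_of_periodic
    ((continuous_decoupledMatrix hp hq).add continuous_const) hper
  set y : ℝ → Fin 2 ⊕ Fin 2 → ℂ := fun x => (Y x).map Complex.ofReal *ᵥ w with hy
  have hy0 : y 0 = w := by
    have : (1 : Matrix (Fin 2 ⊕ Fin 2) (Fin 2 ⊕ Fin 2) ℝ).map Complex.ofReal = 1 :=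
      Matrix.map_one _ Complex.ofReal_zero Complex.ofReal_one
    simp only [hy, h0, this, Matrix.one_mulVec]
  have hderiv := fun (i : Fin 2 ⊕ Fin 2) (x : ℝ) => hasDerivAt_mulVec
    (A := fun x => decoupledMatrix (p x) (q x) + γ • couplingMatrix) w (hY x) i
  have hshift : ∀ x, y (x + 1) = z • y x := fun x => by
    have h1 : ((Y x) * (Y 1)).map Complex.ofReal =
        (Y x).map Complex.ofReal * (Y 1).map Complex.ofReal :=
      Complex.ofRealHom.mapMatrix.map_mul (Y x) (Y 1)
    simp only [hy]
    rw [fundamental_solution_add_one hK hper hY h0, h1, ← Matrix.mulVec_mulVec, hzw,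
      Matrix.mulVec_smul]
  have hbdd : ∀ i, ∃ C, ∀ x, ‖y x i‖ ≤ C := fun i => by
    obtain ⟨C, hC⟩ := exists_bound_of_periodic (A := fun x => ‖y x i‖)
      (continuous_iff_continuousAt.2 fun x => (hderiv i x).continuousAt.norm)
      (fun x => by simp [hshift, hz])
    exact ⟨C, fun x => by simpa using hC x⟩
  choose C hC using hbdd
  refine ⟨fun x => y x (.inl 0), fun x => y x (.inl 1), fun x => y x (.inr 0),
    fun x => y x (.inr 1), ⟨fun x => ?_, fun x => ?_, fun x => ?_, fun x => ?_, ?_, ?_⟩⟩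
  · simpa [decoupledMatrix, couplingMatrix, schrodingerMatrix] using hderiv (.inl 0) x
  · refine (hderiv (.inl 1) x).congr_deriv ?_
    simp [decoupledMatrix, couplingMatrix, schrodingerMatrix, hy, -mul_eq_mul_right_iff]
    ring
  · simpa [decoupledMatrix, couplingMatrix, schrodingerMatrix] using hderiv (.inr 0) x
  · refine (hderiv (.inr 1) x).congr_deriv ?_
    simp [decoupledMatrix, couplingMatrix, schrodingerMatrix, hy, -mul_eq_mul_right_iff]
    ring
  · refine ⟨∑ i, |C i|, fun x => ?_⟩
    have h : ∀ i, ‖y x i‖ ≤ ∑ i, |C i| := fun i => (hC i x).trans ((le_abs_self _).trans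
      (Finset.single_le_sum (f := fun i => |C i|) (fun _ _ => abs_nonneg _) (Finset.mem_univ i)))
    exact ⟨h _, h _, h _, h _⟩
  -- If `u` and `v` vanish identically, so do their derivatives, and the initial vector `w` would be
  -- zero.
  · by_contra! hzero
    have hu : (fun x => y x (.inl 0)) = fun _ => 0 := funext fun x => (hzero x).1
    have hv : (fun x => y x (.inr 0)) = fun _ => 0 := funext fun x => (hzero x).2
    have h1 := hderiv (.inl 0) 0
    have h2 := hderiv (.inr 0) 0
    change HasDerivAt (fun x => y x (.inl 0)) _ 0 at h1
    change HasDerivAt (fun x => y x (.inr 0)) _ 0 at h2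
    rw [hu] at h1
    rw [hv] at h2
    have h1' := h1.unique (hasDerivAt_const 0 0)
    have h2' := h2.unique (hasDerivAt_const 0 0)
    simp [decoupledMatrix, couplingMatrix, schrodingerMatrix] at h1' h2'
    change y 0 (.inl 1) = 0 at h1'
    change y 0 (.inr 1) = 0 at h2'
    apply hw
    rw [← hy0]
    ext i
    rcases i with i | i <;> fin_cases i
    · exact (hzero 0).1
    · exact h1'
    · exact (hzero 0).2
    · exact h2'

/-- A nontrivial solution of `-(1/2)φ'' + q φ = 0` with multiplier `ε = ±1` determines the
trace of the period map. -/
theorem trace_period_map_of_multiplier {q : ℝ → ℝ} (hq : Continuous q)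
    (hqper : Function.Periodic q 1) {W : ℝ → Matrix (Fin 2) (Fin 2) ℝ}
    (hW : ∀ x, HasDerivAt W (schrodingerMatrix (q x) * W x) x) (hW0 : W 0 = 1)
    {φ φ₁ : ℝ → ℝ} (hφ : ∀ x, HasDerivAt φ (φ₁ x) x)
    (hφ₁ : ∀ x, HasDerivAt φ₁ (2 * q x * φ x) x) (hne : ∃ x, φ x ≠ 0) {ε : ℝ} (hε : ε ^ 2 = 1)
    (hmult : ∀ x, φ (x + 1) = ε * φ x) : (W 1).trace = 2 * ε := by
  obtain ⟨K, hK⟩ := exists_bound_of_periodic (continuous_schrodingerMatrix hq)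
    (fun x => by simp only [hqper x])
  have hmult₁ : ∀ x, φ₁ (x + 1) = ε * φ₁ x := fun x => by
    have h1 := (hφ (x + 1)).comp_add_const x 1
    have h2 := (hφ x).const_mul ε
    rw [funext hmult] at h1
    exact h1.unique h2
  -- The vector solution is placed in the first column of a square matrix so that uniqueness in the
  -- matrix algebra applies.
  have hsol : ∀ x, !![φ x, 0; φ₁ x, 0] = W x * !![φ 0, 0; φ₁ 0, 0] := fun x => by
    refine congrFun (linear_ode_unique hK (Y := fun x => !![φ x, 0; φ₁ x, 0])
      (Z := fun x => W x * !![φ 0, 0; φ₁ 0, 0]) (fun x => ?_) (fun x => ?_) (by simp [hW0])) x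
    · refine HasDerivAt.of_matrix_entry fun i j => ?_
      fin_cases i <;> fin_cases j
      · simpa [schrodingerMatrix] using hφ x
      · simpa [schrodingerMatrix] using hasDerivAt_const x (0 : ℝ)
      · simpa [schrodingerMatrix] using hφ₁ x
      · simpa [schrodingerMatrix] using hasDerivAt_const x (0 : ℝ)
    · simpa [mul_assoc] using (hW x).mul_const !![φ 0, 0; φ₁ 0, 0]
  refine trace_of_multiplier (w := ![φ 0, φ₁ 0])
    (det_eq_one_of_planeForm
      (conserved_form_of_linear_ode (fun x => planeForm_conserved (q x)) hW hW0 1))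
    hε (fun h => ?_) ?_
  · have h0 : φ 0 = 0 := congrFun h 0
    have h1 : φ₁ 0 = 0 := congrFun h 1
    obtain ⟨x, hx⟩ := hne
    have := congrFun (congrFun (hsol x) 0) 0
    rw [h0, h1] at this
    exact hx (by simpa [Matrix.mul_apply] using this)
  · have h1 := hsol 1
    have e0 := hmult 0
    have e1 := hmult₁ 0
    rw [zero_add] at e0 e1
    ext i
    have := congrFun (congrFun h1 i) 0
    fin_cases i
    · simpa [Matrix.mul_apply, Matrix.mulVec, dotProduct, e0] using this.symm
    · simpa [Matrix.mul_apply, Matrix.mulVec, dotProduct, e1] using this.symm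

theorem exists_cos_sign_change {t : ℝ} (ht : |t| < 2) {ε : ℝ} (hε : ε ^ 2 = 1) :
    ∃ θ₁ θ₂ : ℝ, ((2 * Real.cos θ₁ - t) * (2 * Real.cos θ₁ - 2 * ε)) *
      ((2 * Real.cos θ₂ - t) * (2 * Real.cos θ₂ - 2 * ε)) < 0 := by
  obtain ⟨h1, h2⟩ := abs_lt.1 ht
  have hc1 : Real.cos (Real.arccos ((t / 2 + 1) / 2)) = (t / 2 + 1) / 2 :=
    Real.cos_arccos (by linarith) (by linarith)
  have hc2 : Real.cos (Real.arccos ((t / 2 - 1) / 2)) = (t / 2 - 1) / 2 :=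
    Real.cos_arccos (by linarith) (by linarith)
  -- The cosines are the midpoints between `t/2` and `±1`: they lie on either side of `t/2` and
  -- strictly inside `(-1, 1)`, so `2 cos θ - 2ε` has the same sign at both.
  refine ⟨Real.arccos ((t / 2 + 1) / 2), Real.arccos ((t / 2 - 1) / 2), ?_⟩
  rw [hc1, hc2]
  have e1 : 2 * ((t / 2 + 1) / 2) - t = (2 - t) / 2 := by ring
  have e2 : 2 * ((t / 2 - 1) / 2) - t = -((2 + t) / 2) := by ring
  rw [e1, e2]
  have hpos : 0 < (2 - t) / 2 * ((2 + t) / 2) := mul_pos (by linarith) (by linarith)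
  have hpos' : 0 < (2 * ((t / 2 + 1) / 2) - 2 * ε) * (2 * ((t / 2 - 1) / 2) - 2 * ε) := by
    rcases mul_self_eq_one_iff.1 ((sq ε).symm.trans hε) with rfl | rfl
    · exact mul_pos_of_neg_of_neg (by linarith) (by linarith)
    · exact mul_pos (by linarith) (by linarith)
  nlinarith [mul_pos hpos hpos']

/-- The determinant sign and the sign change at two fixed angles are strict conditions on the period
map. They hold at `γ = 0`, so they persist on a symmetric interval of `γ`. -/
theorem exists_isBoundedMode {p q : ℝ → ℝ} (hp : Continuous p) (hq : Continuous q)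
    (hpper : Function.Periodic p 1) (hqper : Function.Periodic q 1)
    {φ φ₁ : ℝ → ℝ} (hφ : ∀ x, HasDerivAt φ (φ₁ x) x)
    (hφ₁ : ∀ x, HasDerivAt φ₁ (2 * q x * φ x) x) (hne : ∃ x, φ x ≠ 0) {ε : ℝ} (hε : ε ^ 2 = 1)
    (hmult : ∀ x, φ (x + 1) = ε * φ x) (hband : ZeroInBandInterior p) :
    ∃ δ > 0, ∀ γ : ℝ, |γ| < δ → ∃ u u₁ v v₁ : ℝ → ℂ, IsBoundedMode p q γ u u₁ v v₁ := by
  obtain ⟨_, ⟨U, hU, hU0, rfl⟩, htr⟩ := hband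
  have hU' : ∀ x, HasDerivAt U (schrodingerMatrix (p x) * U x) x := fun x =>
    HasDerivAt.of_matrix_entry (hU x)
  have hdper : Function.Periodic (fun x => decoupledMatrix (p x) (q x)) 1 := fun x => by
    simp only [hpper x, hqper x]
  have hdcont := continuous_decoupledMatrix hp hq
  obtain ⟨Kq, hKq⟩ := exists_bound_of_periodic (continuous_schrodingerMatrix hq)
    (fun x => by simp only [hqper x])
  obtain ⟨K, hK⟩ := exists_bound_of_periodic hdcont hdper
  obtain ⟨W, hW0, hW⟩ := exists_fundamental_solution (continuous_schrodingerMatrix hq) hKq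
  have hYex : ∀ γ : ℝ, ∃ Y : ℝ → Matrix (Fin 2 ⊕ Fin 2) (Fin 2 ⊕ Fin 2) ℝ, Y 0 = 1 ∧
      ∀ x, HasDerivAt Y ((decoupledMatrix (p x) (q x) + γ • couplingMatrix) * Y x) x := fun γ => by
    obtain ⟨K', hK'⟩ := exists_bound_of_periodic (hdcont.add continuous_const) (fun x =>
      congrArg (· + γ • couplingMatrix) (hdper x))
    exact exists_fundamental_solution (hdcont.add continuous_const) hK'
  choose Y hY0 hY using hYex
  have hdetU : (U 1).det = 1 := det_eq_one_of_planeForm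
    (conserved_form_of_linear_ode (fun x => planeForm_conserved (p x)) hU' hU0 1)
  have hdetW : (W 1).det = 1 := det_eq_one_of_planeForm
    (conserved_form_of_linear_ode (fun x => planeForm_conserved (q x)) hW hW0 1)
  have htrW := trace_period_map_of_multiplier hq hqper hW hW0 hφ hφ₁ hne hε hmult
  have hblock : Y 0 1 = Matrix.fromBlocks (U 1) 0 0 (W 1) := by
    refine congrFun (linear_ode_unique hK (Z := fun x => Matrix.fromBlocks (U x) 0 0 (W x))
      (fun x => ?_) (fun x => ?_) ?_) 1
    · have h := hY 0 x
      rw [zero_smul, add_zero] at h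
      exact h
    · have hprod : decoupledMatrix (p x) (q x) * Matrix.fromBlocks (U x) 0 0 (W x) =
          Matrix.fromBlocks (schrodingerMatrix (p x) * U x) 0 0 (schrodingerMatrix (q x) * W x) := by
        simp [decoupledMatrix, Matrix.fromBlocks_multiply]
      rw [hprod]
      refine HasDerivAt.of_matrix_entry fun i j => ?_
      rcases i with i | i <;> rcases j with j | j
      · exact (hU' x).matrix_entry i j
      · exact hasDerivAt_const x (0 : ℝ)
      · exact hasDerivAt_const x (0 : ℝ)
      · exact (hW x).matrix_entry i j
    · simp [hU0, hW0, hY0]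
  have hlim : Tendsto (fun γ => Y γ 1) (𝓝 0) (𝓝 (Y 0 1)) :=
    tendsto_linear_ode_perturbation hK couplingMatrix hY hY0
  obtain ⟨θ₁, θ₂, hθ⟩ := exists_cos_sign_change htr hε
  have hdet : ∀ᶠ γ in 𝓝 (0 : ℝ), 0 < (Y γ 1).det := by
    have h1 : Tendsto (fun γ => (Y γ 1).det) (𝓝 0) (𝓝 (Y 0 1).det) :=
      ((continuous_id.matrix_det).tendsto (Y 0 1)).comp hlim
    refine h1.eventually (lt_mem_nhds ?_)
    rw [hblock, Matrix.det_fromBlocks_zero₂₁, hdetU, hdetW]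
    norm_num
  have hsign : ∀ᶠ γ in 𝓝 (0 : ℝ),
      (unitCircleDet (Y γ 1) θ₁).re * (unitCircleDet (Y γ 1) θ₂).re < 0 := by
    have hc : ∀ θ, Tendsto (fun γ => (unitCircleDet (Y γ 1) θ).re) (𝓝 0)
        (𝓝 (unitCircleDet (Y 0 1) θ).re) := fun θ =>
      ((Complex.continuous_re.comp
        (continuous_unitCircleDet continuous_id continuous_const)).tendsto (Y 0 1)).comp hlim
    refine ((hc θ₁).mul (hc θ₂)).eventually (gt_mem_nhds ?_)
    rw [hblock, unitCircleDet_fromBlocks hdetU hdetW, unitCircleDet_fromBlocks hdetU hdetW,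
      Complex.ofReal_re, Complex.ofReal_re, htrW]
    exact hθ
  obtain ⟨δ, hδ, hball⟩ := Metric.eventually_nhds_iff.1 (hdet.and hsign)
  refine ⟨δ, hδ, fun γ hγ => ?_⟩
  obtain ⟨hd, hs⟩ := hball (y := γ) (by simpa using hγ)
  obtain ⟨z, hz, w, hw, hzw⟩ := exists_unit_eigenvalue det_coupledForm_ne_zero
    (conserved_form_of_linear_ode (fun x => coupledForm_conserved (p x) (q x) γ) (hY γ) (hY0 γ) 1)
    hd hs
  exact exists_isBoundedMode_of_multiplier hp hq hpper hqper (hY γ) (hY0 γ) hz hw hzw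

end

/-! ### Standing-wave profiles and growing solutions -/

section

open Filter Topology Set

section SecondDerivatives

variable {E : Type*} [NormedAddCommGroup E] [NormedSpace ℝ E] {f f₁ f₂ : ℝ → E}

theorem iteratedDeriv_two_of_hasDerivAt (h : ∀ x, HasDerivAt f (f₁ x) x)
    (h₁ : ∀ x, HasDerivAt f₁ (f₂ x) x) (x : ℝ) : iteratedDeriv 2 f x = f₂ x := by
  rw [iteratedDeriv_succ, iteratedDeriv_one, funext fun x => (h x).deriv, (h₁ x).deriv]

theorem contDiff_two_of_hasDerivAt (h : ∀ x, HasDerivAt f (f₁ x) x)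
    (h₁ : ∀ x, HasDerivAt f₁ (f₂ x) x) (hc : Continuous f₂) : ContDiff ℝ 2 f := by
  have e1 : deriv f = f₁ := funext fun x => (h x).deriv
  have e2 : deriv f₁ = f₂ := funext fun x => (h₁ x).deriv
  rw [show (2 : WithTop ℕ∞) = 1 + 1 by norm_num, contDiff_succ_iff_deriv, e1, contDiff_one_iff_deriv,
    e2]
  exact ⟨fun x => (h x).differentiableAt, by simp, fun x => (h₁ x).differentiableAt, hc⟩

theorem ContDiff.hasDerivAt_two (hf : ContDiff ℝ 2 f) :
    (∀ x, HasDerivAt f (deriv f x) x) ∧ ∀ x, HasDerivAt (deriv f) (iteratedDeriv 2 f x) x := by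
  refine ⟨fun x => (hf.differentiable (by norm_num) x).hasDerivAt, fun x => ?_⟩
  rw [iteratedDeriv_succ, iteratedDeriv_one]
  rw [show (2 : WithTop ℕ∞) = 1 + 1 by norm_num, contDiff_succ_iff_deriv] at hf
  exact (hf.2.2.differentiable (by norm_num) x).hasDerivAt

end SecondDerivatives

/-- The profile of a standing wave solves `L₋ φ = 0`. -/
theorem SolvesGrossPitaevskii.profile {σ ω : ℝ} {V φ : ℝ → ℝ}
    (h : SolvesGrossPitaevskii σ V (standingWave ω φ)) :
    ContDiff ℝ 2 φ ∧ ∀ x, iteratedDeriv 2 φ x = 2 * potMinus σ V ω φ x * φ x := by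
  obtain ⟨hx, -, heq⟩ := h
  have h0 : standingWave ω φ 0 = fun x => (φ x : ℂ) := by ext x; simp [standingWave]
  have hc : ContDiff ℝ 2 φ := by
    have := Complex.reCLM.contDiff.comp (hx 0)
    rw [h0] at this
    exact this
  refine ⟨hc, fun x => ?_⟩
  have ht : HasDerivAt (fun s : ℝ => standingWave ω φ s x) (-Complex.I * ω * φ x) 0 := by
    have h1 : HasDerivAt (fun s : ℝ => -Complex.I * ω * (s : ℂ)) (-Complex.I * ω) 0 := by
      simpa using (HasDerivAt.ofReal_comp (hasDerivAt_id (0 : ℝ))).const_mul (-Complex.I * ω)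
    simpa [standingWave] using h1.cexp.mul_const (φ x : ℂ)
  have h2 := iteratedDeriv_two_of_hasDerivAt (fun x => (hc.hasDerivAt_two.1 x).ofReal_comp)
    (fun x => (hc.hasDerivAt_two.2 x).ofReal_comp) x
  have h3 := heq 0 x
  rw [ht.deriv, h0, h2, Complex.norm_real, Real.norm_eq_abs, ← Complex.ofReal_pow, sq_abs] at h3
  have h4 : ((iteratedDeriv 2 φ x : ℝ) : ℂ) = 2 * potMinus σ V ω φ x * φ x := by
    rw [potMinus]
    push_cast at h3 ⊢
    linear_combination 2 * h3 + 2 * ω * φ x * Complex.I_mul_I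
  exact_mod_cast h4

theorem exponentiallyUnstable_of_real_mode {σ ω : ℝ} {V φ : ℝ → ℝ} {γ : ℝ} (hγ : 0 < γ)
    (hp : Continuous (potPlus σ V ω φ)) (hq : Continuous (potMinus σ V ω φ))
    {u u₁ v v₁ : ℝ → ℝ} (hu : ∀ x, HasDerivAt u (u₁ x) x)
    (hu₁ : ∀ x, HasDerivAt u₁ (2 * potPlus σ V ω φ x * u x + 2 * γ * v x) x)
    (hv : ∀ x, HasDerivAt v (v₁ x) x)
    (hv₁ : ∀ x, HasDerivAt v₁ (2 * potMinus σ V ω φ x * v x - 2 * γ * u x) x)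
    (hbdd : ∃ C, ∀ x, |u x| ≤ C ∧ |v x| ≤ C) (hne : ∃ x, u x ≠ 0 ∨ v x ≠ 0) :
    ExponentiallyUnstableAtRate σ V ω φ γ := by
  have hcu : Continuous u := continuous_iff_continuousAt.2 fun x => (hu x).continuousAt
  have hcv : Continuous v := continuous_iff_continuousAt.2 fun x => (hv x).continuousAt
  have hexp : ∀ a t : ℝ, HasDerivAt (fun s : ℝ => Real.exp (γ * s) * a)
      (γ * (Real.exp (γ * t) * a)) t := fun a t => by
    have h1 : HasDerivAt (fun s : ℝ => γ * s) γ t := by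
      simpa using (hasDerivAt_id t).const_mul γ
    exact (h1.exp.mul_const a).congr_deriv (by ring)
  refine ⟨hγ, u, v, hbdd, hne, fun t => ?_, fun t => ?_, fun x t => (hexp _ t).differentiableAt,
    fun x t => (hexp _ t).differentiableAt, fun t x => ⟨?_, ?_⟩⟩
  · exact contDiff_const.mul (contDiff_two_of_hasDerivAt hu hu₁ (by fun_prop))
  · exact contDiff_const.mul (contDiff_two_of_hasDerivAt hv hv₁ (by fun_prop))
  · rw [(hexp (u x) t).deriv, iteratedDeriv_two_of_hasDerivAt
      (fun x => (hv x).const_mul (Real.exp (γ * t)))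
      (fun x => (hv₁ x).const_mul (Real.exp (γ * t)))]
    ring
  · rw [(hexp (v x) t).deriv, iteratedDeriv_two_of_hasDerivAt
      (fun x => (hu x).const_mul (Real.exp (γ * t)))
      (fun x => (hu₁ x).const_mul (Real.exp (γ * t)))]
    ring

/-- The system has real coefficients, so any real-linear functional maps complex modes to real ones;
the real or the imaginary part is nonzero. -/
theorem IsBoundedMode.exponentiallyUnstable {σ ω : ℝ} {V φ : ℝ → ℝ} {γ : ℝ} (hγ : 0 < γ)
    (hp : Continuous (potPlus σ V ω φ)) (hq : Continuous (potMinus σ V ω φ))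
    {u u₁ v v₁ : ℝ → ℂ} (h : IsBoundedMode (potPlus σ V ω φ) (potMinus σ V ω φ) γ u u₁ v v₁) :
    ExponentiallyUnstableAtRate σ V ω φ γ := by
  have key : ∀ L : ℂ →L[ℝ] ℝ, (∃ x, L (u x) ≠ 0 ∨ L (v x) ≠ 0) →
      ExponentiallyUnstableAtRate σ V ω φ γ := fun L hL => by
    have hL1 : ∀ a b : ℝ, ∀ y z : ℂ, L (2 * a * y + 2 * b * z) = 2 * a * L y + 2 * b * L z := by
      intro a b y z
      have : (2 * a * y + 2 * b * z : ℂ) = (2 * a) • y + (2 * b) • z := by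
        simp [Complex.real_smul]
      rw [this, map_add, map_smul, map_smul, smul_eq_mul, smul_eq_mul]
    have hcomp : ∀ {f : ℝ → ℂ} {f' : ℂ} {x : ℝ}, HasDerivAt f f' x →
        HasDerivAt (fun x => L (f x)) (L f') x := fun {f f' x} hf =>
      L.hasFDerivAt.comp_hasDerivAt x hf
    refine exponentiallyUnstable_of_real_mode hγ hp hq (u := fun x => L (u x))
      (v := fun x => L (v x)) (fun x => hcomp (h.deriv_u x))
      (fun x => (hcomp (h.deriv_u₁ x)).congr_deriv (hL1 _ _ _ _))
      (fun x => hcomp (h.deriv_v x))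
      (fun x => (hcomp (h.deriv_v₁ x)).congr_deriv ?_) ?_ hL
    · have := hL1 (potMinus σ V ω φ x) (-γ) (v x) (u x)
      push_cast at this
      rw [sub_eq_add_neg, sub_eq_add_neg, ← neg_mul, ← mul_neg, this]
      ring
    · obtain ⟨C, hC⟩ := h.bounded
      exact ⟨‖L‖ * C, fun x => ⟨L.le_opNorm_of_le (hC x).1, L.le_opNorm_of_le (hC x).2.2.1⟩⟩
  obtain ⟨x, hx⟩ := h.nontrivial
  by_cases hre : (u x).re ≠ 0 ∨ (v x).re ≠ 0
  · exact key Complex.reCLM ⟨x, hre⟩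
  · push Not at hre
    refine key Complex.imCLM ⟨x, ?_⟩
    by_contra! him
    exact hx.elim (fun h => h (Complex.ext hre.1 him.1)) (fun h => h (Complex.ext hre.2 him.2))

end

/-! ### Weak derivatives, L² bounds and cutoffs -/

section

open Filter Topology Set

/-- Both integrations by parts at once: the integrands differ by the derivative of the Wronskian `η'
f - η f'`, which has compact support. -/
theorem integral_ofReal_mul_second_deriv {η η₁ η₂ : ℝ → ℝ} {f f₁ f₂ : ℝ → ℂ}
    (hη : ∀ x, HasDerivAt η (η₁ x) x) (hη₁ : ∀ x, HasDerivAt η₁ (η₂ x) x)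
    (hη₂ : Continuous η₂) (hsupp : HasCompactSupport η) (h : ∀ x, HasDerivAt f (f₁ x) x)
    (h₁ : ∀ x, HasDerivAt f₁ (f₂ x) x) (hf₂ : Continuous f₂) :
    ∫ x, (η₂ x : ℂ) * f x = ∫ x, (η x : ℂ) * f₂ x := by
  have hcη : Continuous η := continuous_iff_continuousAt.2 fun x => (hη x).continuousAt
  have hcη₁ : Continuous η₁ := continuous_iff_continuousAt.2 fun x => (hη₁ x).continuousAt
  have hcf : Continuous f := continuous_iff_continuousAt.2 fun x => (h x).continuousAt
  have hcf₁ : Continuous f₁ := continuous_iff_continuousAt.2 fun x => (h₁ x).continuousAt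
  have hs1 : HasCompactSupport η₁ := (funext fun x => (hη x).deriv) ▸ hsupp.deriv
  have hs2 : HasCompactSupport η₂ := (funext fun x => (hη₁ x).deriv) ▸ hs1.deriv
  have hint : ∀ (k : ℝ → ℝ) (g : ℝ → ℂ), Continuous k → HasCompactSupport k → Continuous g →
      Integrable fun x => (k x : ℂ) * g x := fun k g hk hks hg => by
    refine Continuous.integrable_of_hasCompactSupport
      ((Complex.continuous_ofReal.comp hk).mul hg) ?_
    exact (hks.comp_left (g := Complex.ofReal) Complex.ofReal_zero).mul_right
  have hzero := integral_eq_zero_of_hasDerivAt_of_integrable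
    (f := fun x => (η₁ x : ℂ) * f x - (η x : ℂ) * f₁ x)
    (f' := fun x => (η₂ x : ℂ) * f x - (η x : ℂ) * f₂ x)
    (fun x => by
      refine (((hη₁ x).ofReal_comp.mul (h x)).sub ((hη x).ofReal_comp.mul (h₁ x))).congr_deriv ?_
      ring)
    ((hint _ _ hη₂ hs2 hcf).sub (hint _ _ hcη hsupp hf₂))
    ((hint _ _ hcη₁ hs1 hcf).sub (hint _ _ hcη hsupp hcf₁))
  rwa [integral_sub (hint _ _ hη₂ hs2 hcf) (hint _ _ hcη hsupp hf₂), sub_eq_zero] at hzero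

theorem isWeakSecondDeriv_toLp {f f₁ f₂ : ℝ → ℂ} (h : ∀ x, HasDerivAt f (f₁ x) x)
    (h₁ : ∀ x, HasDerivAt f₁ (f₂ x) x) (hf₂ : Continuous f₂) (hf : MemLp f 2)
    (hg : MemLp f₂ 2) : IsWeakSecondDeriv hf.toLp hg.toLp := by
  intro η hη hsupp
  have h1 := (contDiff_infty_iff_deriv.1 hη).2
  have hη2 : iteratedDeriv 2 η = deriv (deriv η) := by rw [iteratedDeriv_succ, iteratedDeriv_one]
  have key := integral_ofReal_mul_second_deriv
    (fun x => (hη.differentiable (by simp) x).hasDerivAt)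
    (fun x => (h1.differentiable (by simp) x).hasDerivAt)
    (h1.continuous_deriv (by simp)) hsupp h h₁ hf₂
  rw [hη2]
  refine Eq.trans (integral_congr_ae ?_) (key.trans (integral_congr_ae ?_))
  · filter_upwards [hf.coeFn_toLp] with x hx
    rw [hx]
  · filter_upwards [hg.coeFn_toLp] with x hx
    rw [hx]

theorem norm_toLp_two_le {f : ℝ → ℂ} (hf : MemLp f 2) {M R : ℝ} (hM : 0 ≤ M) (hR : 0 ≤ R)
    (hbound : ∀ x, ‖f x‖ ≤ M) (hsupp : ∀ x, R < |x| → f x = 0) :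
    ‖hf.toLp‖ ≤ Real.sqrt (2 * R) * M := by
  have hind : f = (Icc (-R) R).indicator f := by
    ext x
    rw [indicator_apply]
    split_ifs with hx
    · rfl
    · exact hsupp x (by rwa [mem_Icc, ← abs_le, not_le] at hx)
  rw [Lp.norm_toLp]
  refine ENNReal.toReal_le_of_le_ofReal (by positivity) ?_
  rw [hind, eLpNorm_indicator_eq_eLpNorm_restrict measurableSet_Icc]
  refine (eLpNorm_le_of_ae_bound (.of_forall hbound)).trans_eq ?_
  rw [Measure.restrict_apply_univ, Real.volume_Icc, ENNReal.ofReal_mul (by positivity),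
    Real.sqrt_eq_rpow, ← ENNReal.ofReal_rpow_of_nonneg (by positivity) (by norm_num)]
  rw [show R - -R = 2 * R by ring]
  norm_num [mul_comm]

/-- A smooth cutoff, with two derivatives. -/
theorem exists_cutoff : ∃ χ χ₁ χ₂ : ℝ → ℝ, (∀ x, HasDerivAt χ (χ₁ x) x) ∧
    (∀ x, HasDerivAt χ₁ (χ₂ x) x) ∧ Continuous χ₂ ∧
    (∃ B, ∀ x, |χ₁ x| ≤ B ∧ |χ₂ x| ≤ B) ∧ (∀ x, |χ x| ≤ 1) ∧ (∀ x, |x| ≤ 1 → χ x = 1) ∧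
    ∀ x, 2 < |x| → χ x = 0 ∧ χ₁ x = 0 ∧ χ₂ x = 0 := by
  let χ : ContDiffBump (0 : ℝ) := ⟨1, 2, one_pos, one_lt_two⟩
  have h0 : ContDiff ℝ ((⊤ : ℕ∞) : WithTop ℕ∞) χ := χ.contDiff
  have h1 : ContDiff ℝ ((⊤ : ℕ∞) : WithTop ℕ∞) (deriv χ) := (contDiff_infty_iff_deriv.1 h0).2
  have hc2 : Continuous (deriv (deriv χ)) := h1.continuous_deriv (by simp)
  have hs1 : HasCompactSupport (deriv χ) := χ.hasCompactSupport.deriv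
  obtain ⟨B₁, hB₁⟩ := h1.continuous.bounded_above_of_compact_support hs1
  obtain ⟨B₂, hB₂⟩ := hc2.bounded_above_of_compact_support hs1.deriv
  refine ⟨χ, deriv χ, deriv (deriv χ), fun x => (h0.differentiable (by simp) x).hasDerivAt,
    fun x => (h1.differentiable (by simp) x).hasDerivAt, hc2,
    ⟨max B₁ B₂, fun x => ⟨(hB₁ x).trans (le_max_left _ _), (hB₂ x).trans (le_max_right _ _)⟩⟩,
    fun x => by rw [abs_of_nonneg χ.nonneg]; exact χ.le_one,
    fun x hx => χ.one_of_mem_closedBall (by simpa using hx), fun x hx => ?_⟩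
  have hx0 : x ∉ tsupport χ := by
    rw [χ.tsupport_eq]
    simpa using hx
  have hx1 : x ∉ tsupport (deriv χ) := fun h => hx0 (tsupport_deriv_subset h)
  exact ⟨image_eq_zero_of_notMem_tsupport hx0, image_eq_zero_of_notMem_tsupport hx1,
    image_eq_zero_of_notMem_tsupport fun h => hx1 (tsupport_deriv_subset h)⟩

theorem memLp_two_of_continuous_of_zero_outside {f : ℝ → ℂ} (hf : Continuous f) {R : ℝ}
    (hsupp : ∀ x, R < |x| → f x = 0) : MemLp f 2 := by
  refine hf.memLp_of_hasCompactSupport (HasCompactSupport.intro (isCompact_Icc (a := -R) (b := R))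
    fun x hx => hsupp x ?_)
  rwa [mem_Icc, ← abs_le, not_le] at hx

theorem norm_toLp_pos {f : ℝ → ℂ} (hf : Continuous f) (hfm : MemLp f 2) {x : ℝ} (hx : f x ≠ 0) :
    0 < ‖hfm.toLp‖ := by
  refine norm_pos_iff.2 fun h0 => hx ?_
  have h1 : f =ᵐ[volume] fun _ => (0 : ℂ) :=
    hfm.coeFn_toLp.symm.trans (h0 ▸ Lp.coeFn_zero ℂ 2 volume)
  exact congrFun ((hf.ae_eq_iff_eq volume continuous_const).1 h1) x

theorem norm_toLp_mono {f g : ℝ → ℂ} (hf : MemLp f 2) (hg : MemLp g 2)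
    (h : ∀ x, ‖f x‖ ≤ ‖g x‖) : ‖hf.toLp‖ ≤ ‖hg.toLp‖ := by
  rw [Lp.norm_toLp, Lp.norm_toLp]
  exact ENNReal.toReal_mono hg.2.ne (eLpNorm_mono h)

end

/-! ### Weyl sequences and the Bogoliubov spectrum -/

section

open Filter Topology Set

/-- The truncation of `u` by the cutoff `χ (c x)`. -/
def truncation (χ : ℝ → ℝ) (c : ℝ) (u : ℝ → ℂ) (x : ℝ) : ℂ := (χ (c * x) : ℂ) * u x

/-- The commutator of `-(1/2)∂²` with the cutoff `χ (c x)`, applied to `u`;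
`χ₁, χ₂` and `u₁` stand for derivatives. -/
noncomputable def truncationError (χ₁ χ₂ : ℝ → ℝ) (c : ℝ) (u u₁ : ℝ → ℂ) (x : ℝ) : ℂ :=
  -(1 / 2) * ((c ^ 2 * χ₂ (c * x) : ℝ) * u x + 2 * ((c * χ₁ (c * x) : ℝ) * u₁ x))

section Truncation

variable {χ χ₁ χ₂ : ℝ → ℝ} {c : ℝ} {u u₁ u₂ : ℝ → ℂ}

theorem continuous_truncation (hχ : Continuous χ) (hu : Continuous u) :
    Continuous (truncation χ c u) := by
  unfold truncation; fun_prop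

theorem continuous_truncationError (hχ₁ : Continuous χ₁) (hχ₂ : Continuous χ₂)
    (hu : Continuous u) (hu₁ : Continuous u₁) : Continuous (truncationError χ₁ χ₂ c u u₁) := by
  unfold truncationError; fun_prop

theorem lt_abs_mul_of_div_lt {c r x : ℝ} (hc : 0 < c) (hx : r / c < |x|) : r < |c * x| := by
  rw [abs_mul, abs_of_pos hc]
  rwa [div_lt_iff₀' hc] at hx

theorem truncation_eq_zero (hc : 0 < c) (hχ : ∀ x, 2 < |x| → χ x = 0) {x : ℝ} (hx : 2 / c < |x|) :
    truncation χ c u x = 0 := by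
  rw [truncation, hχ _ (lt_abs_mul_of_div_lt hc hx), Complex.ofReal_zero, zero_mul]

theorem truncationError_eq_zero (hc : 0 < c) (hχ₁ : ∀ x, 2 < |x| → χ₁ x = 0)
    (hχ₂ : ∀ x, 2 < |x| → χ₂ x = 0) {x : ℝ} (hx : 2 / c < |x|) :
    truncationError χ₁ χ₂ c u u₁ x = 0 := by
  rw [truncationError, hχ₁ _ (lt_abs_mul_of_div_lt hc hx), hχ₂ _ (lt_abs_mul_of_div_lt hc hx)]
  simp

/-- Every derivative of the cutoff costs a factor `c`, and `c ^ 2 ≤ c`. -/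
theorem norm_truncationError_le (hc : 0 < c) (hc1 : c ≤ 1) {B C : ℝ} (hB₁ : ∀ x, |χ₁ x| ≤ B)
    (hB₂ : ∀ x, |χ₂ x| ≤ B) (hC : ∀ x, ‖u x‖ ≤ C) (hC₁ : ∀ x, ‖u₁ x‖ ≤ C) (x : ℝ) :
    ‖truncationError χ₁ χ₂ c u u₁ x‖ ≤ c * (2 * (B * C)) := by
  have hB0 : 0 ≤ B := (abs_nonneg _).trans (hB₁ 0)
  have hC0 : 0 ≤ C := (norm_nonneg _).trans (hC 0)
  have e1 : ‖((c ^ 2 * χ₂ (c * x) : ℝ) : ℂ) * u x‖ ≤ c * (B * C) := by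
    rw [norm_mul, Complex.norm_real, Real.norm_eq_abs, abs_mul, abs_of_pos (by positivity),
      mul_assoc]
    gcongr
    · nlinarith
    · exact hB₂ _
    · exact hC x
  have e2 : ‖((c * χ₁ (c * x) : ℝ) : ℂ) * u₁ x‖ ≤ c * (B * C) := by
    rw [norm_mul, Complex.norm_real, Real.norm_eq_abs, abs_mul, abs_of_pos hc, mul_assoc]
    gcongr
    · exact hB₁ _
    · exact hC₁ x
  have e3 : 0 ≤ c * (B * C) := by positivity
  rw [truncationError, norm_mul]
  have h2 : ‖(2 : ℂ) * (((c * χ₁ (c * x) : ℝ) : ℂ) * u₁ x)‖ ≤ 2 * (c * (B * C)) := by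
    rw [norm_mul, Complex.norm_ofNat]; linarith
  have h3 := norm_add_le (((c ^ 2 * χ₂ (c * x) : ℝ) : ℂ) * u x)
    (2 * (((c * χ₁ (c * x) : ℝ) : ℂ) * u₁ x))
  have h4 : ‖(-(1 / 2) : ℂ)‖ = 1 / 2 := by norm_num
  rw [h4]
  linarith

/-- `(-(1/2)∂² + q) (χ u) = χ g + [-(1/2)∂², χ] u` in `L²(ℝ)` if `-(1/2)u'' + q u = g`. -/
theorem schrodingerGraph_truncation (hc : 0 < c) (hχ : ∀ x, HasDerivAt χ (χ₁ x) x)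
    (hχ₁ : ∀ x, HasDerivAt χ₁ (χ₂ x) x) (hχ₂ : Continuous χ₂)
    (hsupp : ∀ x, 2 < |x| → χ x = 0 ∧ χ₁ x = 0 ∧ χ₂ x = 0) {q : ℝ → ℝ}
    (hu : ∀ x, HasDerivAt u (u₁ x) x) (hu₁ : ∀ x, HasDerivAt u₁ (u₂ x) x) (hu₂ : Continuous u₂)
    (hF : MemLp (truncation χ c u) 2) {g : ℝ → ℂ} (hg : ∀ x, -(1 / 2) * u₂ x + q x * u x = g x)
    {G : L2} (hG : ∀ᵐ x, G x = truncationError χ₁ χ₂ c u u₁ x + truncation χ c g x) :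
    SchrodingerGraph q hF.toLp G := by
  have hcχ : Continuous χ := continuous_iff_continuousAt.2 fun x => (hχ x).continuousAt
  have hcχ₁ : Continuous χ₁ := continuous_iff_continuousAt.2 fun x => (hχ₁ x).continuousAt
  have hcu : Continuous u := continuous_iff_continuousAt.2 fun x => (hu x).continuousAt
  have hcu₁ : Continuous u₁ := continuous_iff_continuousAt.2 fun x => (hu₁ x).continuousAt
  have hlin : ∀ x : ℝ, HasDerivAt (fun x : ℝ => c * x) c x := fun x => by
    simpa using (hasDerivAt_id x).const_mul c
  have hd1 : ∀ x, HasDerivAt (fun x => χ (c * x)) (c * χ₁ (c * x)) x := fun x =>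
    ((hχ (c * x)).comp x (hlin x)).congr_deriv (mul_comm _ _)
  have hd2 : ∀ x, HasDerivAt (fun x => c * χ₁ (c * x)) (c ^ 2 * χ₂ (c * x)) x := fun x =>
    (((hχ₁ (c * x)).comp x (hlin x)).const_mul c).congr_deriv (by ring)
  set F₁ : ℝ → ℂ := fun x => (c * χ₁ (c * x) : ℝ) * u x + (χ (c * x) : ℝ) * u₁ x with hF₁
  set F₂ : ℝ → ℂ := fun x => ((c ^ 2 * χ₂ (c * x) : ℝ) * u x + (c * χ₁ (c * x) : ℝ) * u₁ x) +
    ((c * χ₁ (c * x) : ℝ) * u₁ x + (χ (c * x) : ℝ) * u₂ x) with hF₂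
  have hD1 : ∀ x, HasDerivAt (truncation χ c u) (F₁ x) x := fun x =>
    (hd1 x).ofReal_comp.mul (hu x)
  have hD2 : ∀ x, HasDerivAt F₁ (F₂ x) x := fun x =>
    ((hd2 x).ofReal_comp.mul (hu x)).add ((hd1 x).ofReal_comp.mul (hu₁ x))
  have hcF₂ : Continuous F₂ := by fun_prop
  have hF₂m : MemLp F₂ 2 := memLp_two_of_continuous_of_zero_outside hcF₂ (R := 2 / c)
    fun x hx => by
      obtain ⟨h0, h1, h2⟩ := hsupp _ (lt_abs_mul_of_div_lt hc hx)
      simp [hF₂, h0, h1, h2]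
  refine ⟨hF₂m.toLp, isWeakSecondDeriv_toLp hD1 hD2 hcF₂ hF hF₂m, ?_⟩
  filter_upwards [hG, hF.coeFn_toLp, hF₂m.coeFn_toLp] with x h1 h2 h3
  rw [h1, h2, h3, truncation, truncation, truncationError, ← hg x]
  simp only [hF₂]
  ring

end Truncation

/-- The commutator error has size `O(c)` on an interval of length `O(1/c)`, so its L² norm is
`O(√c)`. A bounded inverse would force the truncated modes to zero, but their norms stay bounded
below. -/
theorem IsBoundedMode.mem_bogoliubovSpectrum {σ ω : ℝ} {V φ : ℝ → ℝ} {τ : ℝ}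
    (hp : Continuous (potPlus σ V ω φ)) (hq : Continuous (potMinus σ V ω φ))
    {u u₁ v v₁ : ℝ → ℂ} (h : IsBoundedMode (potPlus σ V ω φ) (potMinus σ V ω φ) τ u u₁ v v₁) :
    (τ : ℂ) * Complex.I ∈ bogoliubovSpectrum σ V ω φ := by
  rintro ⟨R, hR⟩
  obtain ⟨χ, χ₁, χ₂, hχ, hχ₁, hχ₂, ⟨B, hB⟩, hχle, hχone, hsupp⟩ := exists_cutoff
  obtain ⟨C, hC⟩ := h.bounded
  have hcχ : Continuous χ := continuous_iff_continuousAt.2 fun x => (hχ x).continuousAt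
  have hcχ₁ : Continuous χ₁ := continuous_iff_continuousAt.2 fun x => (hχ₁ x).continuousAt
  have hcu : Continuous u := continuous_iff_continuousAt.2 fun x => (h.deriv_u x).continuousAt
  have hcu₁ : Continuous u₁ := continuous_iff_continuousAt.2 fun x => (h.deriv_u₁ x).continuousAt
  have hcv : Continuous v := continuous_iff_continuousAt.2 fun x => (h.deriv_v x).continuousAt
  have hcv₁ : Continuous v₁ := continuous_iff_continuousAt.2 fun x => (h.deriv_v₁ x).continuousAt
  -- With `w = i v` the mode equations become `L₋ w = iτ u`, `L₊ u = iτ w`.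
  set w : ℝ → ℂ := fun x => Complex.I * v x with hw
  set w₁ : ℝ → ℂ := fun x => Complex.I * v₁ x with hw₁
  have hcw : Continuous w := by fun_prop
  have hcw₁ : Continuous w₁ := by fun_prop
  have htrunc : ∀ {c : ℝ} {f : ℝ → ℂ}, 0 < c → Continuous f → MemLp (truncation χ c f) 2 :=
    fun hc hf => memLp_two_of_continuous_of_zero_outside (continuous_truncation hcχ hf)
      fun x hx => truncation_eq_zero hc (fun x hx => (hsupp x hx).1) hx
  have herr : ∀ {c : ℝ} {f f₁ : ℝ → ℂ}, 0 < c → Continuous f → Continuous f₁ →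
      MemLp (truncationError χ₁ χ₂ c f f₁) 2 := fun hc hf hf₁ =>
    memLp_two_of_continuous_of_zero_outside (continuous_truncationError hcχ₁ hχ₂ hf hf₁)
      fun x hx => truncationError_eq_zero hc (fun x hx => (hsupp x hx).2.1)
        (fun x hx => (hsupp x hx).2.2) hx
  -- the truncated mode is an approximate eigenfunction
  have hsmall : ∀ c : ℝ, ∀ hc : 0 < c, c ≤ 1 →
      ‖(((htrunc hc hcu).toLp, (htrunc hc hcw).toLp) : L2 × L2)‖ ≤
        ‖R‖ * (Real.sqrt (2 * (2 / c)) * (c * (2 * (B * C)))) := by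
    intro c hc hc1
    set f : L2 × L2 := ((htrunc hc hcu).toLp, (htrunc hc hcw).toLp) with hf
    -- The errors of `w` and `u` appear in swapped order because the operator is off-diagonal.
    set k : L2 × L2 := ((herr hc hcw hcw₁).toLp, (herr hc hcu hcu₁).toLp) with hk
    have hgraph : BogoliubovGraph σ V ω φ f (k + ((τ : ℂ) * Complex.I) • f) := by
      constructor
      · refine schrodingerGraph_truncation hc hχ hχ₁ hχ₂ hsupp
          (fun x => (h.deriv_v x).const_mul Complex.I)
          (fun x => (h.deriv_v₁ x).const_mul Complex.I) (by fun_prop) (htrunc hc hcw)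
          (g := fun x => (τ : ℂ) * Complex.I * u x) (fun x => by ring) ?_
        filter_upwards [Lp.coeFn_add k.1 (((τ : ℂ) * Complex.I) • f.1),
          Lp.coeFn_smul ((τ : ℂ) * Complex.I) f.1, (herr hc hcw hcw₁).coeFn_toLp,
          (htrunc hc hcu).coeFn_toLp] with x h1 h2 h3 h4
        refine h1.trans ?_
        rw [Pi.add_apply, h2, Pi.smul_apply]
        refine congrArg₂ (· + ·) h3 ((congrArg (((τ : ℂ) * Complex.I) • ·) h4).trans ?_)
        simp only [truncation, smul_eq_mul]
        ring
      · refine schrodingerGraph_truncation hc hχ hχ₁ hχ₂ hsupp h.deriv_u h.deriv_u₁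
          (by fun_prop) (htrunc hc hcu) (g := fun x => (τ : ℂ) * Complex.I * w x)
          (fun x => by simp only [hw]; linear_combination (-τ * v x) * Complex.I_mul_I) ?_
        filter_upwards [Lp.coeFn_add k.2 (((τ : ℂ) * Complex.I) • f.2),
          Lp.coeFn_smul ((τ : ℂ) * Complex.I) f.2, (herr hc hcu hcu₁).coeFn_toLp,
          (htrunc hc hcw).coeFn_toLp] with x h1 h2 h3 h4
        refine h1.trans ?_
        rw [Pi.add_apply, h2, Pi.smul_apply]
        refine congrArg₂ (· + ·) h3 ((congrArg (((τ : ℂ) * Complex.I) • ·) h4).trans ?_)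
        simp only [truncation, smul_eq_mul]
        ring
    have hk_le : ‖k‖ ≤ Real.sqrt (2 * (2 / c)) * (c * (2 * (B * C))) := by
      have hB0 : 0 ≤ B := (abs_nonneg _).trans (hB 0).1
      have hC0 : 0 ≤ C := (norm_nonneg _).trans (hC 0).1
      have hzero : ∀ (f f₁ : ℝ → ℂ) (x : ℝ), 2 / c < |x| → truncationError χ₁ χ₂ c f f₁ x = 0 :=
        fun f f₁ x hx => truncationError_eq_zero hc (fun x hx => (hsupp x hx).2.1)
          (fun x hx => (hsupp x hx).2.2) hx
      refine max_le (norm_toLp_two_le (herr hc hcw hcw₁) (by positivity) (by positivity) ?_ (hzero _ _))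
        (norm_toLp_two_le (herr hc hcu hcu₁) (by positivity) (by positivity) ?_ (hzero _ _))
      · exact norm_truncationError_le hc hc1 (fun x => (hB x).1) (fun x => (hB x).2)
          (fun x => by simpa [hw] using (hC x).2.2.1) (fun x => by simpa [hw₁] using (hC x).2.2.2)
      · exact norm_truncationError_le hc hc1 (fun x => (hB x).1) (fun x => (hB x).2)
          (fun x => (hC x).1) (fun x => (hC x).2.1)
    rw [(hR f k).1 hgraph]
    exact R.le_opNorm_of_le hk_le
  -- and its norm is bounded below
  obtain ⟨x₀, hx₀⟩ := h.nontrivial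
  set c₀ : ℝ := 1 / (|x₀| + 1) with hc₀
  have hc₀pos : 0 < c₀ := by positivity
  have hχx₀ : χ (c₀ * x₀) = 1 := by
    refine hχone _ ?_
    rw [abs_mul, abs_of_pos hc₀pos, hc₀, one_div_mul_eq_div, div_le_one (by positivity)]
    linarith
  -- For `c ≤ c₀ / 2` the wider cutoff equals one wherever `|x| ≤ 2 / c₀`, and the narrower one
  -- vanishes elsewhere.
  have hmono : ∀ {c : ℝ} {f : ℝ → ℂ} (hc : 0 < c) (hf : Continuous f), c ≤ c₀ / 2 →
      ‖(htrunc hc₀pos hf).toLp‖ ≤ ‖(htrunc hc hf).toLp‖ := by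
    intro c f hc hf hcc
    refine norm_toLp_mono _ _ fun x => ?_
    by_cases hx : 2 / c₀ < |x|
    · rw [truncation_eq_zero hc₀pos (fun x hx => (hsupp x hx).1) hx, norm_zero]
      exact norm_nonneg _
    · have hx1 : χ (c * x) = 1 := by
        refine hχone _ ?_
        rw [not_lt, le_div_iff₀ hc₀pos] at hx
        rw [abs_mul, abs_of_pos hc]
        nlinarith [mul_le_mul_of_nonneg_right hcc (abs_nonneg x)]
      rw [truncation, truncation, hx1, norm_mul, norm_mul, Complex.norm_real, Complex.norm_real,
        norm_one]
      exact mul_le_mul_of_nonneg_right (hχle _) (norm_nonneg _)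
  obtain ⟨m, hm, hlower⟩ : ∃ m > 0, ∀ c : ℝ, ∀ hc : 0 < c, c ≤ c₀ / 2 →
      m ≤ ‖(((htrunc hc hcu).toLp, (htrunc hc hcw).toLp) : L2 × L2)‖ := by
    rcases hx₀ with hx₀ | hx₀
    · exact ⟨_, norm_toLp_pos (continuous_truncation hcχ hcu) (htrunc hc₀pos hcu) (x := x₀)
        (by simpa [truncation, hχx₀] using hx₀), fun c hc hcc =>
          (hmono hc hcu hcc).trans (le_max_left _ _)⟩
    · exact ⟨_, norm_toLp_pos (continuous_truncation hcχ hcw) (htrunc hc₀pos hcw) (x := x₀)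
        (by simpa [truncation, hχx₀, hw] using hx₀), fun c hc hcc =>
          (hmono hc hcw hcc).trans (le_max_right _ _)⟩
  have hlim : Tendsto (fun c : ℝ => ‖R‖ * (Real.sqrt (2 * (2 / c)) * (c * (2 * (B * C)))))
      (𝓝[>] 0) (𝓝 0) := by
    have h1 : Tendsto (fun c : ℝ => ‖R‖ * (2 * Real.sqrt c * (2 * (B * C)))) (𝓝[>] 0) (𝓝 0) := by
      have : Continuous fun c : ℝ => ‖R‖ * (2 * Real.sqrt c * (2 * (B * C))) := by fun_prop
      simpa using (this.tendsto 0).mono_left nhdsWithin_le_nhds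
    refine h1.congr' ?_
    filter_upwards [self_mem_nhdsWithin] with c hc
    have hc : 0 < c := hc
    have e : Real.sqrt (2 * (2 / c)) * c = 2 * Real.sqrt c := by
      have hs : Real.sqrt c * Real.sqrt c = c := Real.mul_self_sqrt hc.le
      have hs0 : Real.sqrt c ≠ 0 := (Real.sqrt_pos.2 hc).ne'
      rw [show 2 * (2 / c) = 2 ^ 2 / c by ring, Real.sqrt_div (by norm_num),
        Real.sqrt_sq (by norm_num), div_mul_eq_mul_div, div_eq_iff hs0]
      linear_combination -2 * hs
    rw [← mul_assoc (Real.sqrt _), e]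
  obtain ⟨c, hcm, hc, hcc⟩ := ((hlim.eventually (gt_mem_nhds hm)).and
    (Ioc_mem_nhdsGT (lt_min one_pos (half_pos hc₀pos)))).exists
  exact absurd ((hlower c hc (hcc.trans (min_le_right _ _))).trans
    (hsmall c hc (hcc.trans (min_le_left _ _)))) (not_le.2 hcm)

end

/-! ### The instability theorem -/

theorem mainTheorem1 (σ : ℝ) (hσ : σ = 1 ∨ σ = -1)
    (V : ℝ → ℝ) (hV : Continuous V) (hVper : Function.Periodic V 1)
    (ω : ℝ) (φ : ℝ → ℝ) (hφne : ∃ x, φ x ≠ 0)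
    (hφper : Function.Periodic φ 1 ∨ Function.Antiperiodic φ 1)
    (hφ : SolvesGrossPitaevskii σ V (standingWave ω φ))
    (hband : ZeroInBandInterior (potPlus σ V ω φ)) :
    ∃ δ : ℝ, 0 < δ ∧
      (∀ τ : ℝ, |τ| < δ → (τ : ℂ) * Complex.I ∈ bogoliubovSpectrum σ V ω φ) ∧
      (∀ γ : ℝ, 0 < γ → γ < δ → ExponentiallyUnstableAtRate σ V ω φ γ) := by
  obtain ⟨hφc, hφeq⟩ := hφ.profile
  have hcont : Continuous φ := hφc.continuous
  have hp : Continuous (potPlus σ V ω φ) := by unfold potPlus; fun_prop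
  have hq : Continuous (potMinus σ V ω φ) := by unfold potMinus; fun_prop
  -- The potentials involve only `φ ^ 2`, so they have period one even for antiperiodic `φ`.
  have hsq : ∀ x, φ (x + 1) ^ 2 = φ x ^ 2 := fun x => by
    rcases hφper with h | h
    · rw [h x]
    · rw [h x, neg_sq]
  obtain ⟨ε, hε, hmult⟩ : ∃ ε : ℝ, ε ^ 2 = 1 ∧ ∀ x, φ (x + 1) = ε * φ x := by
    rcases hφper with h | h
    · exact ⟨1, by norm_num, fun x => by rw [h x, one_mul]⟩
    · exact ⟨-1, by norm_num, fun x => by rw [h x, neg_one_mul]⟩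
  obtain ⟨δ, hδ, hmode⟩ := exists_isBoundedMode hp hq
    (fun x => by rw [potPlus, potPlus, hVper x, hsq])
    (fun x => by rw [potMinus, potMinus, hVper x, hsq])
    hφc.hasDerivAt_two.1 (fun x => (hφc.hasDerivAt_two.2 x).congr_deriv (hφeq x)) hφne hε hmult
    hband
  refine ⟨δ, hδ, fun τ hτ => ?_, fun γ hγ hγδ => ?_⟩
  · obtain ⟨u, u₁, v, v₁, h⟩ := hmode τ hτ
    exact h.mem_bogoliubovSpectrum hp hq
  · obtain ⟨u, u₁, v, v₁, h⟩ := hmode γ (by rwa [abs_of_pos hγ])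
    exact h.exponentiallyUnstable hγ hp hq
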